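/- Let $\mathbb{K}\in\{\mathbb{R},\mathbb{C}\}$, let $V$ be a finite-dimensional $\mathbb{K}$-vector space, let $U\subseteq\mathbb{R}^n$ be an open neighborhood of $0$, and write $C^\infty(U,V)$ for the $\mathbb{K}$-vector space of (real-)smooth functions $U\to V$. Eigenvalues of an endomorphism of a finite-dimensional space are the complex roots of its characteristic polynomial, counted with multiplicity. Let $X\in C^\infty(U,\mathbb{R}^n)$ be a vector field with a strictly positive source at $0$, i.e. $X(0)=0$ and all eigenvalues $\mu_1,\dots,\mu_n$ of the linearization $\mathrm{D}X|_0$ have strictly positive real part. Assume that $U$ is star-shaped around $0$ with respect to $X$, i.e. for every $q\in U$ the flow $\Phi_t(q)$ of $X$ exists and lies in $U$ for all $t\le 0$, and $\Phi_t(q)\to 0$ as $t\to-\infty$. Let $A\in C^\infty(U,\mathrm{End}(V))$, $v\in C^\infty(U,V)$, $\lambda\in\mathbb{K}$, and put $((\mathrm{D}_X+A)u)(y)=\mathrm{D}u(y)[X(y)]+A(y)u(y)$. For $N\in\mathbb{N}_0$ let $\mathfrak{m}^{N}\subseteq C^\infty(U,V)$ be the subspace of functions all of whose derivatives of order $<N$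 vanish at $0$, let $\mathcal{P}_N=C^\infty(U,V)/\mathfrak{m}^{N+1}$, let $[u]_N\in\mathcal{P}_N$ be the class of $u$ (its $N$-jet at $0$), and let $[\mathrm{D}_X+A]_N$ be the well-defined linear operator on $\mathcal{P}_N$ with $[\mathrm{D}_X+A]_N[u]_N=[(\mathrm{D}_X+A)u]_N$. **Theorem (Correspondence).** Let $N\in\mathbb{N}_0$ be such that $|\alpha|\le N$ for every representation $$\lambda=\alpha_1\mu_1+\dots+\alpha_n\mu_n+\rho$$ of $\lambda$ with a multi-index $\alpha\in\mathbb{N}_0^n$ and an eigenvalue $\rho$ of $A(0)$ (no condition on $N$ if $\lambda$ has no such representation). Then $\mathcal{P}_N$ is finite-dimensional, and the map $u\mapsto[u]_N$ is a bijection from the set of solutions $u\in C^\infty(U,V)$ of $$(\mathrm{D}_X+A)u=\lambda u+v$$ onto the set of solutions $\boldsymbol{u}\in\mathcal{P}_N$ of the projected equation $$[\mathrm{D}_X+A]_N\,\boldsymbol{u}=\lambda\boldsymbol{u}+[v]_N .$$ In particular one of these solution sets is empty if and only if the other one is; if they are non-empty, $u\mapsto[u]_N$ is an isomorphism of affine spaces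 over $\mathbb{K}$ between them. -/

import Mathlib

open scoped ContDiff Topology

/-- The standard embedding of the scalar field `𝕜 = ℝ` or `𝕜 = ℂ` into the complex numbers. -/
def scalarToComplex (𝕜 : Type*) [RCLike 𝕜] : 𝕜 →+* ℂ where
  toFun x := (RCLike.re x : ℂ) + (RCLike.im x : ℂ) * Complex.I
  map_one' := by simp
  map_zero' := by simp
  map_add' x y := by simp only [map_add, Complex.ofReal_add]; ring
  map_mul' x y := by
    simp only [RCLike.mul_re, RCLike.mul_im, Complex.ofReal_sub, Complex.ofReal_add,
      Complex.ofReal_mul]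
    linear_combination (-(RCLike.im x : ℂ) * (RCLike.im y : ℂ)) * Complex.I_mul_I

/-- The (generalized) eigenvalues of an endomorphism of a finite-dimensional real or complex
vector space: the complex roots of its characteristic polynomial, with multiplicity. -/
noncomputable def complexEigenvalues {𝕜 W : Type*} [RCLike 𝕜] [AddCommGroup W] [Module 𝕜 W]
    [FiniteDimensional 𝕜 W] (f : Module.End 𝕜 W) : Multiset ℂ :=
  (f.charpoly.map (scalarToComplex 𝕜)).roots

section Spaces

variable {n : ℕ}

/-- The space `C^∞(U, V)` of smooth (in the real sense) functions on the open set `U ⊆ ℝⁿ` with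
values in `V`, as a vector space over `𝕜`. A function on `U` is represented by its unique extension
to `ℝⁿ` that vanishes identically outside `U` (no regularity across the boundary is required). -/
def SmoothFun (𝕜 : Type*) [RCLike 𝕜] (U : TopologicalSpace.Opens (EuclideanSpace ℝ (Fin n)))
    (V : Type*) [NormedAddCommGroup V] [NormedSpace ℝ V] [NormedSpace 𝕜 V] [IsScalarTower ℝ 𝕜 V] :
    Submodule 𝕜 (EuclideanSpace ℝ (Fin n) → V) where
  carrier := {u | ContDiffOn ℝ ∞ u U ∧ ∀ y ∉ U, u y = 0}
  add_mem' {u w} hu hw := ⟨hu.1.add hw.1, fun y hy => by simp [hu.2 y hy, hw.2 y hy]⟩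
  zero_mem' := ⟨contDiffOn_const, fun _ _ => rfl⟩
  smul_mem' c u hu := ⟨hu.1.const_smul c, fun y hy => by simp [hu.2 y hy]⟩

theorem SmoothFun.contDiffAt {𝕜 : Type*} [RCLike 𝕜]
    {U : TopologicalSpace.Opens (EuclideanSpace ℝ (Fin n))}
    {V : Type*} [NormedAddCommGroup V] [NormedSpace ℝ V] [NormedSpace 𝕜 V] [IsScalarTower ℝ 𝕜 V]
    (u : SmoothFun 𝕜 U V) {y : EuclideanSpace ℝ (Fin n)} (hy : y ∈ U) :
    ContDiffAt ℝ ∞ u.1 y :=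
  u.2.1.contDiffAt (U.isOpen.mem_nhds hy)

/-- The subspace `𝔪^N ⊆ C^∞(U, V)` of the functions all of whose derivatives of order `< N` vanish
at the origin (which is assumed to lie in `U`). -/
def vanishingIdeal (𝕜 : Type*) [RCLike 𝕜] (U : TopologicalSpace.Opens (EuclideanSpace ℝ (Fin n)))
    (V : Type*) [NormedAddCommGroup V] [NormedSpace ℝ V] [NormedSpace 𝕜 V] [IsScalarTower ℝ 𝕜 V]
    (h0 : (0 : EuclideanSpace ℝ (Fin n)) ∈ U) (N : ℕ) : Submodule 𝕜 (SmoothFun 𝕜 U V) where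
  carrier := {u | ∀ k < N, iteratedFDeriv ℝ k u.1 0 = 0}
  add_mem' {u w} hu hw k hk := by
    have h := iteratedFDeriv_add_apply (i := k) (f := u.1) (g := w.1)
      ((SmoothFun.contDiffAt u h0).of_le (by exact_mod_cast le_top))
      ((SmoothFun.contDiffAt w h0).of_le (by exact_mod_cast le_top))
    rw [hu k hk, hw k hk, add_zero] at h
    exact h
  zero_mem' k _ := by
    change iteratedFDeriv ℝ k (fun _ => (0 : V)) 0 = 0
    simp
  smul_mem' c u hu k hk := by
    have h := iteratedFDeriv_const_smul_apply (i := k) (f := u.1) (a := c)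
      ((SmoothFun.contDiffAt u h0).of_le (by exact_mod_cast le_top))
    rw [hu k hk, smul_zero] at h
    exact h

/-- The jet space `𝒫_N = C^∞(U, V) / 𝔪^(N+1)`. -/
abbrev JetSpace (𝕜 : Type*) [RCLike 𝕜] (U : TopologicalSpace.Opens (EuclideanSpace ℝ (Fin n)))
    (V : Type*) [NormedAddCommGroup V] [NormedSpace ℝ V] [NormedSpace 𝕜 V] [IsScalarTower ℝ 𝕜 V]
    (h0 : (0 : EuclideanSpace ℝ (Fin n)) ∈ U) (N : ℕ) : Type _ :=
  SmoothFun 𝕜 U V ⧸ vanishingIdeal 𝕜 U V h0 (N + 1)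

/-- The projection `u ↦ [u]_N` onto the jet space `𝒫_N`. -/
def jet (𝕜 : Type*) [RCLike 𝕜] (U : TopologicalSpace.Opens (EuclideanSpace ℝ (Fin n)))
    (V : Type*) [NormedAddCommGroup V] [NormedSpace ℝ V] [NormedSpace 𝕜 V] [IsScalarTower ℝ 𝕜 V]
    (h0 : (0 : EuclideanSpace ℝ (Fin n)) ∈ U) (N : ℕ) :
    SmoothFun 𝕜 U V →ₗ[𝕜] JetSpace 𝕜 U V h0 N :=
  (vanishingIdeal 𝕜 U V h0 (N + 1)).mkQ

variable {𝕜 : Type*} [RCLike 𝕜] {U : TopologicalSpace.Opens (EuclideanSpace ℝ (Fin n))}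
  {V : Type*} [NormedAddCommGroup V] [NormedSpace ℝ V] [NormedSpace 𝕜 V] [IsScalarTower ℝ 𝕜 V]

/-- The first order operator `(D_X + A) u (y) = Du(y)[X(y)] + A(y) u(y)` on `C^∞(U, V)`. -/
noncomputable def transportOp (X : SmoothFun ℝ U (EuclideanSpace ℝ (Fin n)))
    (A : SmoothFun 𝕜 U (V →L[𝕜] V)) : SmoothFun 𝕜 U V →ₗ[𝕜] SmoothFun 𝕜 U V where
  toFun u := ⟨fun y => fderiv ℝ u.1 y (X.1 y) + A.1 y (u.1 y), by
    constructor
    · refine ContDiffOn.add ?_ ?_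
      · exact (u.2.1.fderiv_of_isOpen U.isOpen (m := ∞) (by simp)).clm_apply X.2.1
      · have hA : ContDiffOn ℝ ∞ (fun y => (A.1 y).restrictScalars ℝ) U :=
          (ContinuousLinearMap.restrictScalarsL 𝕜 V V ℝ ℝ).contDiff.comp_contDiffOn A.2.1
        exact hA.clm_apply u.2.1
    · intro y hy
      simp [X.2.2 y hy, A.2.2 y hy]⟩
  map_add' u w := by
    ext y
    by_cases hy : y ∈ U
    · have hu := (SmoothFun.contDiffAt u hy).differentiableAt (by simp)
      have hw := (SmoothFun.contDiffAt w hy).differentiableAt (by simp)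
      have h := congrArg (fun L => L (X.1 y)) (fderiv_add hu hw)
      simp only [Submodule.coe_add, Pi.add_apply, map_add] at h ⊢
      rw [h, add_apply]
      abel
    · simp [X.2.2 y hy, A.2.2 y hy]
  map_smul' c u := by
    ext y
    by_cases hy : y ∈ U
    · have hu := (SmoothFun.contDiffAt u hy).differentiableAt (by simp)
      have h := congrArg (fun L => L (X.1 y)) (fderiv_const_smul hu c)
      simp only [Submodule.coe_smul, Pi.smul_apply, map_smul, RingHom.id_apply] at h ⊢
      rw [h, smul_apply, smul_add]
    · simp [X.2.2 y hy, A.2.2 y hy]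

/-- If `X` vanishes at the origin, then `D_X + A` maps `𝔪^N` to `𝔪^N`. -/
theorem vanishingIdeal_le_comap_transportOp (h0 : (0 : EuclideanSpace ℝ (Fin n)) ∈ U)
    (X : SmoothFun ℝ U (EuclideanSpace ℝ (Fin n))) (hX : X.1 0 = 0)
    (A : SmoothFun 𝕜 U (V →L[𝕜] V)) (N : ℕ) :
    vanishingIdeal 𝕜 U V h0 N ≤ (vanishingIdeal 𝕜 U V h0 N).comap (transportOp X A) := by
  intro u hu k hk
  have hU : UniqueDiffOn ℝ (U : Set (EuclideanSpace ℝ (Fin n))) := U.isOpen.uniqueDiffOn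
  have hder : ∀ i < N, iteratedFDerivWithin ℝ i u.1 U 0 = 0 := fun i hi => by
    rw [iteratedFDerivWithin_of_isOpen i U.isOpen h0]; exact hu i hi
  have hf : ContDiffOn ℝ ∞ (fun y => fderivWithin ℝ u.1 U y) U :=
    u.2.1.fderivWithin hU (by simp)
  have hA : ContDiffOn ℝ ∞ (fun y => (A.1 y).restrictScalars ℝ) U :=
    (ContinuousLinearMap.restrictScalarsL 𝕜 V V ℝ ℝ).contDiff.comp_contDiffOn A.2.1
  have hk' : (k : ℕ∞ω) ≤ ∞ := by exact_mod_cast le_top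
  have h1 : iteratedFDerivWithin ℝ k (fun y => fderivWithin ℝ u.1 U y (X.1 y)) U 0 = 0 := by
    have hb := ContinuousLinearMap.norm_iteratedFDerivWithin_le_of_bilinear
      (ContinuousLinearMap.id ℝ (EuclideanSpace ℝ (Fin n) →L[ℝ] V)) hf X.2.1 hU h0 hk'
    rw [Finset.sum_eq_zero, mul_zero] at hb
    · exact norm_le_zero_iff.mp hb
    · intro i hi
      rcases (Nat.lt_succ_iff.mp (Finset.mem_range.mp hi)).lt_or_eq with hik | rfl
      · rw [norm_iteratedFDerivWithin_fderivWithin hU h0, hder (i + 1) (by omega)]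
        simp
      · have h : iteratedFDerivWithin ℝ (i - i) X.1 U 0 = 0 := by
          rw [← norm_eq_zero, Nat.sub_self, norm_iteratedFDerivWithin_zero, hX, norm_zero]
        rw [h, norm_zero, mul_zero]
  have h2 : iteratedFDerivWithin ℝ k (fun y => A.1 y (u.1 y)) U 0 = 0 := by
    have hb := ContinuousLinearMap.norm_iteratedFDerivWithin_le_of_bilinear
      (ContinuousLinearMap.id ℝ (V →L[ℝ] V)) hA u.2.1 hU h0 hk'
    rw [Finset.sum_eq_zero, mul_zero] at hb
    · exact norm_le_zero_iff.mp hb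
    · intro i hi
      rw [hder (k - i) (by omega)]
      simp
  have hc1 : ContDiffOn ℝ k (fun y => fderivWithin ℝ u.1 U y (X.1 y)) U :=
    (hf.clm_apply X.2.1).of_le hk'
  have hc2 : ContDiffOn ℝ k (fun y => A.1 y (u.1 y)) U :=
    (hA.clm_apply u.2.1).of_le hk'
  have h3 := iteratedFDerivWithin_add_apply (hc1 0 h0) (hc2 0 h0) hU h0
  rw [h1, h2, add_zero] at h3
  rw [← iteratedFDerivWithin_of_isOpen k U.isOpen h0, ← h3]
  refine iteratedFDerivWithin_congr (fun y hy => ?_) h0 k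
  simp [transportOp, fderivWithin_of_isOpen U.isOpen hy]

/-- The induced operator `[D_X + A]_N` on `𝒫_N`, characterised by
`[D_X + A]_N [u]_N = [(D_X + A) u]_N`. -/
noncomputable def jetOp (h0 : (0 : EuclideanSpace ℝ (Fin n)) ∈ U)
    (X : SmoothFun ℝ U (EuclideanSpace ℝ (Fin n))) (hX : X.1 0 = 0)
    (A : SmoothFun 𝕜 U (V →L[𝕜] V)) (N : ℕ) :
    JetSpace 𝕜 U V h0 N →ₗ[𝕜] JetSpace 𝕜 U V h0 N :=
  Submodule.mapQ _ _ (transportOp X A) (vanishingIdeal_le_comap_transportOp h0 X hX A (N + 1))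

/-- The linearization `DX|_0` of `X` at the origin. -/
noncomputable def linearization (X : SmoothFun ℝ U (EuclideanSpace ℝ (Fin n))) :
    Module.End ℝ (EuclideanSpace ℝ (Fin n)) :=
  (fderiv ℝ X.1 0 : EuclideanSpace ℝ (Fin n) →ₗ[ℝ] EuclideanSpace ℝ (Fin n))

/-- The origin is a strictly positive source of `X`: it is a zero of `X` at which all eigenvalues of
the linearization have strictly positive real part. -/
structure IsStrictlyPositiveSource (X : SmoothFun ℝ U (EuclideanSpace ℝ (Fin n))) : Prop where
  apply_zero : X.1 0 = 0
  re_pos : ∀ μ ∈ complexEigenvalues (linearization X), 0 < μ.re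

/-- `U` is star-shaped around the origin with respect to `X`: the backward flow `t ↦ Φ_t(q)`
of every `q ∈ U` exists for all `t ≤ 0`, stays in `U`, and tends to the origin as `t → -∞`. -/
def IsStarShaped (X : SmoothFun ℝ U (EuclideanSpace ℝ (Fin n))) : Prop :=
  ∀ q ∈ U, ∃ γ : ℝ → EuclideanSpace ℝ (Fin n), γ 0 = q ∧
    IsIntegralCurveOn γ (fun _ => X.1) (Set.Iic 0) ∧ (∀ t ≤ 0, γ t ∈ U) ∧
    Filter.Tendsto γ Filter.atBot (𝓝 0)

end Spaces

/-- The affine space of solutions `u` of `L u = c u + v`; it may be empty. -/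
def solutionSpace {𝕜 W : Type*} [Field 𝕜] [AddCommGroup W] [Module 𝕜 W] (L : W →ₗ[𝕜] W)
    (c : 𝕜) (v : W) : AffineSubspace 𝕜 W where
  carrier := {u | L u = c • u + v}
  smul_vsub_vadd_mem' a p q r hp hq hr := by
    simp only [Set.mem_ofPred_eq] at hp hq hr
    simp only [Set.mem_ofPred_eq, vsub_eq_sub, vadd_eq_add, map_add, map_smul, map_sub, hp, hq, hr]
    module

/-! Put L = D_X + A - λ. Everything comes down to L being a bijection of 𝔪^(N+1) onto itself: a
trivial kernel there (`eq_zero_of_shiftedTransportOp_eq_zero`) makes the jet of a solution determine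
it, and surjectivity there (`exists_shiftedTransportOp_eq`) corrects any representative of a jet
solution to a true solution.

Formal half. On derivatives of order k at 0, modulo lower ones, L acts on k-linear maps with
eigenvalues among ρ - λ plus a sum of k of the μ_i. None of these is zero for k > N, so an element
of 𝔪^(N+1) vanishes to at least the order of its image. On finite-dimensional jet spaces injectivity
implies surjectivity, hence Lp = w is solvable modulo every 𝔪^M.

Analytic half. Along a trajectory σ of -X the equation reads z' = (A - λ)z - w. A Lyapunov form for
DX(0) and star-shapedness make trajectories tend to 0 exponentially and stably under perturbation of
the starting point (`exists_isSourceFlow`). If w vanishes to high order, w∘σ decays so fast that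
exactly one solution z decays at a comparable rate, and u(q) = z(0) is the candidate solution.

Regularity. The pair (u, Du) should solve an equation of the same kind. That equation is solved
first, and a quadratic estimate identifies its second component as the derivative of its first. The
required decay rate depends on the number k of derivatives, so for each k one writes u = p_k - s_k
with p_k smooth (formal half) and s_k of class C^k (analytic half). By uniqueness p_k - s_k does not
depend on k, so u is smooth. -/

/-! ### Eigenvalues of sums of commuting endomorphisms -/

section Spectrum

open Polynomial

theorem mem_complexEigenvalues_iff {𝕜 W : Type*} [RCLike 𝕜] [AddCommGroup W] [Module 𝕜 W]
    [FiniteDimensional 𝕜 W] (f : Module.End 𝕜 W) (z : ℂ) :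
    z ∈ complexEigenvalues f ↔ (f.charpoly.map (scalarToComplex 𝕜)).IsRoot z :=
  mem_roots ((LinearMap.charpoly_monic f).map _).ne_zero

theorem scalarToComplex_comp_algebraMap (𝕜 : Type*) [RCLike 𝕜] :
    (scalarToComplex 𝕜).comp (algebraMap ℝ 𝕜) = scalarToComplex ℝ := by
  ext r
  simp [scalarToComplex]

theorem Polynomial.IsRoot.of_hasEigenvector {K W : Type*} [Field K] [AddCommGroup W] [Module K W]
    {f : Module.End K W} {p : K[X]} (hp : aeval f p = 0) {z : K} {x : W}
    (hx : f.HasEigenvector z x) : p.IsRoot z := by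
  have h := Module.End.aeval_apply_of_hasEigenvector (p := p) hx
  rw [hp, LinearMap.zero_apply] at h
  exact (smul_eq_zero.mp h.symm).resolve_right hx.2

/-- The eigenspace of f + g is invariant under f, so f has an eigenvector in it, and this is then an
eigenvector of g = (f + g) - f as well. -/
theorem Module.End.exists_hasEigenvector_of_hasEigenvalue_add {K W : Type*} [Field K]
    [IsAlgClosed K] [AddCommGroup W] [Module K W] [FiniteDimensional K W] {f g : Module.End K W}
    (hfg : Commute f g) {z : K} (hz : (f + g).HasEigenvalue z) :
    ∃ a b : K, ∃ x, f.HasEigenvector a x ∧ g.HasEigenvector b x ∧ z = a + b := by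
  have hmaps : ∀ x ∈ (f + g).eigenspace z, f x ∈ (f + g).eigenspace z := by
    intro x hx
    rw [Module.End.mem_eigenspace_iff] at hx ⊢
    have h1 : f (g x) = g (f x) := LinearMap.congr_fun hfg x
    rw [← map_smul, ← hx]
    simp [h1]
  have : Nontrivial ((f + g).eigenspace z) := Submodule.nontrivial_iff_ne_bot.mpr hz
  obtain ⟨a, ha⟩ := Module.End.exists_eigenvalue (f.restrict hmaps)
  obtain ⟨x, hx⟩ := ha.exists_hasEigenvector
  have hx0 : (x : W) ≠ 0 := fun h => hx.2 (Subtype.ext h)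
  have hfx : f x = a • (x : W) := congrArg Subtype.val hx.apply_eq_smul
  have hsum : f x + g x = z • (x : W) := Module.End.mem_eigenspace_iff.mp x.2
  have hgx : g x = (z - a) • (x : W) := by rw [sub_smul, ← hsum, hfx]; abel
  exact ⟨a, z - a, x, Module.End.hasEigenvector_iff.mpr ⟨Module.End.mem_eigenspace_iff.mpr hfx, hx0⟩,
    Module.End.hasEigenvector_iff.mpr ⟨Module.End.mem_eigenspace_iff.mpr hgx, hx0⟩, by ring⟩

/-- The eigenvalues of a sum of commuting endomorphisms `f` and `g` that are annihilated by the
polynomials `p` and `q` are sums of complex roots of `p` and `q`. -/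
theorem exists_isRoot_of_mem_complexEigenvalues_add {𝕜 W : Type*} [RCLike 𝕜] [AddCommGroup W]
    [Module 𝕜 W] [FiniteDimensional 𝕜 W] {f g : Module.End 𝕜 W} (hfg : Commute f g)
    {p q : 𝕜[X]} (hp : aeval f p = 0) (hq : aeval g q = 0) {z : ℂ}
    (hz : z ∈ complexEigenvalues (f + g)) :
    ∃ a b : ℂ, (p.map (scalarToComplex 𝕜)).IsRoot a ∧ (q.map (scalarToComplex 𝕜)).IsRoot b ∧
      z = a + b := by
  -- Extend scalars to ℂ, where eigenvectors exist; characteristic polynomials and annihilating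
  -- polynomials are compatible with this.
  let _ : Algebra 𝕜 ℂ := (scalarToComplex 𝕜).toAlgebra
  let Φ := Module.End.baseChangeHom 𝕜 ℂ W
  have hmap : ∀ (h : Module.End 𝕜 W) (r : 𝕜[X]), aeval h r = 0 →
      aeval (Φ h) (r.map (scalarToComplex 𝕜)) = 0 := by
    intro h r hr
    have h1 : aeval (Φ h) (r.map (algebraMap 𝕜 ℂ)) = aeval (Φ h) r := by
      rw [aeval_map_algebraMap]
    have h2 : aeval (Φ h) r = Φ (aeval h r) := by rw [aeval_algHom_apply]
    rw [hr, map_zero] at h2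
    exact h1.trans h2
  have hroot : (Φ (f + g)).HasEigenvalue z := by
    rw [Module.End.hasEigenvalue_iff_isRoot_charpoly]
    have := LinearMap.charpoly_baseChange (f + g) ℂ
    change (LinearMap.baseChange ℂ (f + g)).charpoly.IsRoot z
    rw [this]
    exact (mem_complexEigenvalues_iff _ _).mp hz
  rw [map_add] at hroot
  obtain ⟨a, b, x, hx, hx', rfl⟩ :=
    Module.End.exists_hasEigenvector_of_hasEigenvalue_add (hfg.map Φ) hroot
  exact ⟨a, b, .of_hasEigenvector (hmap f p hp) hx, .of_hasEigenvector (hmap g q hq) hx', rfl⟩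

theorem Polynomial.aeval_apply_of_intertwine {R W W' : Type*} [CommRing R] [AddCommGroup W]
    [Module R W] [AddCommGroup W'] [Module R W'] (f : Module.End R W) (g : Module.End R W')
    (i : W → W') (hadd : ∀ x y, i (x + y) = i x + i y) (hsmul : ∀ (c : R) x, i (c • x) = c • i x)
    (h : ∀ x, g (i x) = i (f x)) (p : R[X]) (x : W) : aeval g p (i x) = i (aeval f p x) := by
  induction p using Polynomial.induction_on' with
  | add p q hp hq => simp [hp, hq, hadd]
  | monomial k c =>
    have : ∀ y, (g ^ k) (i y) = i ((f ^ k) y) := by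
      induction k with
      | zero => simp
      | succ k ih => intro y; rw [pow_succ, pow_succ, Module.End.mul_apply, h, ih]; rfl
    simp [aeval_monomial, Module.algebraMap_end_apply, this, hsmul]

end Spectrum

/-! ### Spectrum of the operator induced on multilinear maps -/

section Nonresonant

universe u

variable {E : Type} [NormedAddCommGroup E] [NormedSpace ℝ E]

/-- The operator `g ↦ f ∘ g + g ∘ B` on `Hom(E, V)`. -/
noncomputable def homOp {V : Type u} [NormedAddCommGroup V] [NormedSpace ℝ V]
    (f : V →L[ℝ] V) (B : E →L[ℝ] E) : (E →L[ℝ] V) →L[ℝ] (E →L[ℝ] V) :=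
  ContinuousLinearMap.compL ℝ E V V f + (ContinuousLinearMap.compL ℝ E E V).flip B

@[simp]
theorem homOp_apply {V : Type u} [NormedAddCommGroup V] [NormedSpace ℝ V]
    (f : V →L[ℝ] V) (B : E →L[ℝ] E) (g : E →L[ℝ] V) : homOp f B g = f.comp g + g.comp B := rfl

/-- Injectivity of the operator induced by `f` and `B` on the `k`-linear maps `E × ⋯ × E → V`. -/
def NonresonantAt (B : E →L[ℝ] E) : ℕ → ∀ {V : Type u} [NormedAddCommGroup V]
    [NormedSpace ℝ V], (V →L[ℝ] V) → Prop
  | 0, _, _, _, f => Function.Injective f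
  | k + 1, _, _, _, f => NonresonantAt B k (homOp f B)

variable {𝕜 : Type*} [RCLike 𝕜] [FiniteDimensional ℝ E]

theorem finiteDimensional_continuousLinearMap (𝕜 : Type*) [RCLike 𝕜] (E : Type)
    [NormedAddCommGroup E] [NormedSpace ℝ E] [FiniteDimensional ℝ E] (V : Type u)
    [NormedAddCommGroup V] [NormedSpace ℝ V] [NormedSpace 𝕜 V] [IsScalarTower ℝ 𝕜 V]
    [FiniteDimensional 𝕜 V] : FiniteDimensional 𝕜 (E →L[ℝ] V) := by
  have : FiniteDimensional ℝ V := FiniteDimensional.trans ℝ 𝕜 V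
  exact Module.Finite.of_restrictScalars_finite ℝ 𝕜 _

/-- Postcomposition with f and precomposition with B commute and are annihilated by the
characteristic polynomials of f and B. The annihilating polynomials suffice, so the spectrum on
Hom(E, V) need not be computed with multiplicities. -/
theorem exists_of_mem_complexEigenvalues_homOp {V : Type u} [NormedAddCommGroup V]
    [NormedSpace ℝ V] [NormedSpace 𝕜 V] [IsScalarTower ℝ 𝕜 V] [FiniteDimensional 𝕜 V]
    [FiniteDimensional 𝕜 (E →L[ℝ] V)]
    (B : E →L[ℝ] E) (f : Module.End 𝕜 V) (F : V →L[ℝ] V) (hF : ∀ x, F x = f x)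
    (f' : Module.End 𝕜 (E →L[ℝ] V)) (hf' : ∀ g, f' g = homOp F B g) {z : ℂ}
    (hz : z ∈ complexEigenvalues f') :
    ∃ ρ ∈ complexEigenvalues f, ∃ β ∈ complexEigenvalues (B : E →ₗ[ℝ] E), z = ρ + β := by
  let f₁ : Module.End 𝕜 (E →L[ℝ] V) :=
    { toFun := fun g => F.comp g
      map_add' := fun g h => by ext; simp
      map_smul' := fun c g => by ext; simp [hF] }
  let f₂ : Module.End 𝕜 (E →L[ℝ] V) :=
    { toFun := fun g => g.comp B
      map_add' := fun g h => by ext; simp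
      map_smul' := fun c g => by ext; simp }
  have hsum : f' = f₁ + f₂ := LinearMap.ext fun g => hf' g
  have hcomm : Commute f₁ f₂ := LinearMap.ext fun g => rfl
  have hp : Polynomial.aeval f₁ f.charpoly = 0 := by
    refine LinearMap.ext fun g => ContinuousLinearMap.ext fun x => ?_
    have := Polynomial.aeval_apply_of_intertwine f₁ f (fun g => g x) (fun _ _ => rfl)
      (fun _ _ => rfl) (fun g => (hF _).symm) f.charpoly g
    rw [LinearMap.aeval_self_charpoly] at this
    exact this.symm
  have hq : Polynomial.aeval f₂
      (((B : E →ₗ[ℝ] E).charpoly).map (algebraMap ℝ 𝕜)) = 0 := by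
    refine LinearMap.ext fun g => ContinuousLinearMap.ext fun x => ?_
    have key : ∀ p : Polynomial ℝ, ∀ g : E →L[ℝ] V, ∀ x,
        Polynomial.aeval f₂ (p.map (algebraMap ℝ 𝕜)) g x =
          g (Polynomial.aeval (B : E →ₗ[ℝ] E) p x) := by
      intro p
      induction p using Polynomial.induction_on' with
      | add p q hp hq =>
        intro g x
        rw [Polynomial.map_add, map_add, map_add, LinearMap.add_apply, add_apply, hp, hq]
        simp
      | monomial k c =>
        have : ∀ (g : E →L[ℝ] V) (x : E), (f₂ ^ k) g x = g (((B : E →ₗ[ℝ] E) ^ k) x) := by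
          induction k with
          | zero => simp
          | succ k ih => intro g x; rw [pow_succ, pow_succ', Module.End.mul_apply, ih]; rfl
        intro g x
        rw [Polynomial.map_monomial, Polynomial.aeval_monomial, Polynomial.aeval_monomial]
        simp [Module.algebraMap_end_apply, this]
    rw [key, LinearMap.aeval_self_charpoly]
    simp
  rw [hsum] at hz
  obtain ⟨a, b, ha, hb, rfl⟩ := exists_isRoot_of_mem_complexEigenvalues_add hcomm hp hq hz
  refine ⟨a, (mem_complexEigenvalues_iff _ _).mpr ha, b, (mem_complexEigenvalues_iff _ _).mpr ?_,
    rfl⟩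
  rwa [Polynomial.map_map, scalarToComplex_comp_algebraMap] at hb

theorem scalarToComplex_mem_complexEigenvalues {W : Type*} [AddCommGroup W] [Module 𝕜 W]
    [FiniteDimensional 𝕜 W] {f : Module.End 𝕜 W} {c : 𝕜} (h : f.HasEigenvalue c) :
    scalarToComplex 𝕜 c ∈ complexEigenvalues f :=
  (mem_complexEigenvalues_iff _ _).mpr
    (((Module.End.hasEigenvalue_iff_isRoot_charpoly f c).mp h).map)

/-- By currying, a (k+1)-linear map to V is a k-linear map to Hom(E, V). Each step of the induction
passes to Hom(E, V) and adds one eigenvalue of B, which the multiset s collects. The 𝕜-linear f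
carries the spectrum, while F is its shift seen as a real map. -/
theorem nonresonantAt_of_forall_ne (B : E →L[ℝ] E) (c : 𝕜) (k : ℕ) {V : Type u}
    [NormedAddCommGroup V] [NormedSpace ℝ V] [NormedSpace 𝕜 V] [IsScalarTower ℝ 𝕜 V]
    [FiniteDimensional 𝕜 V] (f : Module.End 𝕜 V) (F : V →L[ℝ] V)
    (hF : ∀ x, F x = f x - c • x)
    (h : ∀ (s : Multiset ℂ) (ρ : ℂ), s.card = k →
      (∀ β ∈ s, β ∈ complexEigenvalues (B : E →ₗ[ℝ] E)) → ρ ∈ complexEigenvalues f →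
      scalarToComplex 𝕜 c ≠ s.sum + ρ) :
    NonresonantAt B k F := by
  induction k generalizing V with
  | zero =>
    refine (injective_iff_map_eq_zero F).mpr fun x hx => ?_
    by_contra hx0
    rw [hF, sub_eq_zero] at hx
    have := Module.End.hasEigenvalue_of_hasEigenvector
      (Module.End.hasEigenvector_iff.mpr ⟨Module.End.mem_eigenspace_iff.mpr hx, hx0⟩)
    exact h 0 _ rfl (by simp) (scalarToComplex_mem_complexEigenvalues this) (by simp)
  | succ k ih =>
    have := finiteDimensional_continuousLinearMap 𝕜 E V
    -- Undo the shift: `homOp F B` is `homOp F₁ B` minus c, so c is subtracted once in all, not once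
    -- for every argument.
    let F₁ : V →L[ℝ] V := F + c • ContinuousLinearMap.id ℝ V
    have hF₁ : ∀ x, F₁ x = f x := fun x => by simp [F₁, hF]
    let f' : Module.End 𝕜 (E →L[ℝ] V) :=
      { toFun := fun g => homOp F₁ B g
        map_add' := fun g h => map_add _ g h
        map_smul' := fun c g => by ext; simp [hF₁] }
    refine ih (V := E →L[ℝ] V) f' (homOp F B) (fun g => ?_) fun s ρ hs hsB hρ heq => ?_
    · ext x
      simp only [homOp_apply, add_apply, ContinuousLinearMap.coe_comp, Function.comp_apply, hF,
        sub_apply, smul_apply, f', LinearMap.coe_mk, AddHom.coe_mk, hF₁]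
      abel
    · obtain ⟨ρ', hρ', β, hβ, rfl⟩ :=
        exists_of_mem_complexEigenvalues_homOp B f F₁ hF₁ f' (fun _ => rfl) hρ
      refine h (β ::ₘ s) ρ' (by simp [hs]) (fun b hb => ?_) hρ' (by rw [heq]; simp; ring)
      rcases Multiset.mem_cons.mp hb with rfl | hb
      exacts [hβ, hsB b hb]

end Nonresonant

/-! ### A Lyapunov form for the linearization -/

section Lyapunov

variable {E : Type*} [NormedAddCommGroup E] [NormedSpace ℝ E]

/-- Precomposition with `B`, as an endomorphism of the complexified dual space. -/
noncomputable def complexDualMap (B : E →ₗ[ℝ] E) : Module.End ℂ (E →ₗ[ℝ] ℂ) where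
  toFun l := l ∘ₗ B
  map_add' _ _ := rfl
  map_smul' _ _ := rfl

theorem aeval_complexDualMap (B : E →ₗ[ℝ] E) (p : Polynomial ℝ) (l : E →ₗ[ℝ] ℂ) (x : E) :
    Polynomial.aeval (complexDualMap B) (p.map (algebraMap ℝ ℂ)) l x =
      l (Polynomial.aeval B p x) := by
  induction p using Polynomial.induction_on' generalizing l x with
  | add p q hp hq =>
    rw [Polynomial.map_add, map_add, map_add, LinearMap.add_apply, LinearMap.add_apply, hp, hq]
    simp
  | monomial k c =>
    have : ∀ (l : E →ₗ[ℝ] ℂ) (x : E), (complexDualMap B ^ k) l x = l ((B ^ k) x) := by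
      induction k with
      | zero => simp
      | succ k ih => intro g x; rw [pow_succ, pow_succ', Module.End.mul_apply, ih]; rfl
    rw [Polynomial.map_monomial, Polynomial.aeval_monomial, Polynomial.aeval_monomial]
    simp [Module.algebraMap_end_apply, this]

theorem mem_complexEigenvalues_of_complexDualMap [FiniteDimensional ℝ E] (B : E →ₗ[ℝ] E) {μ : ℂ}
    (h : (complexDualMap B).HasEigenvalue μ) : μ ∈ complexEigenvalues B := by
  have hB : Polynomial.aeval (complexDualMap B) (B.charpoly.map (algebraMap ℝ ℂ)) = 0 := by
    refine LinearMap.ext fun l => LinearMap.ext fun x => ?_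
    rw [aeval_complexDualMap, LinearMap.aeval_self_charpoly]
    simp
  obtain ⟨x, hx⟩ := h.exists_hasEigenvector
  have := Polynomial.IsRoot.of_hasEigenvector hB hx
  have hs : scalarToComplex ℝ = algebraMap ℝ ℂ := by
    ext r
    simp [scalarToComplex]
  rwa [mem_complexEigenvalues_iff, hs]

/-- A positive semidefinite form that dominates the functional `l` and grows along `B` at rate at
least `δ`. -/
def IsControlled (B : E →ₗ[ℝ] E) (δ : ℝ) (l : E →ₗ[ℝ] ℂ) : Prop :=
  ∃ (b : E →L[ℝ] E →L[ℝ] ℝ) (C : ℝ), 0 < C ∧ (∀ x y, b x y = b y x) ∧ (∀ x, 0 ≤ b x x) ∧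
    (∀ x, ‖l x‖ ^ 2 ≤ C * b x x) ∧ ∀ x, δ * b x x ≤ b x (B x)

theorem IsControlled.zero (B : E →ₗ[ℝ] E) (δ : ℝ) : IsControlled B δ 0 :=
  ⟨0, 1, one_pos, by simp, by simp, by simp, by simp⟩

theorem IsControlled.add {B : E →ₗ[ℝ] E} {δ : ℝ} {l l' : E →ₗ[ℝ] ℂ} (h : IsControlled B δ l)
    (h' : IsControlled B δ l') : IsControlled B δ (l + l') := by
  obtain ⟨b, C, hC, hs, hp, hl, hg⟩ := h
  obtain ⟨b', C', hC', hs', hp', hl', hg'⟩ := h'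
  refine ⟨b + b', 2 * (C + C'), by positivity, fun x y => by simp [hs x, hs' x],
    fun x => add_nonneg (hp x) (hp' x), fun x => ?_, fun x => ?_⟩
  · have h1 : ‖l x + l' x‖ ≤ ‖l x‖ + ‖l' x‖ := norm_add_le _ _
    have h2 : ‖l x + l' x‖ ^ 2 ≤ (‖l x‖ + ‖l' x‖) ^ 2 := by gcongr
    simp only [LinearMap.add_apply, add_apply]
    nlinarith [sq_nonneg (‖l x‖ - ‖l' x‖), hl x, hl' x, mul_nonneg hC.le (hp' x),
      mul_nonneg hC'.le (hp x)]
  · simp only [add_apply]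
    linarith [hg x, hg' x]

theorem inner_mul_self (μ z : ℂ) : inner ℝ z (μ * z) = μ.re * ‖z‖ ^ 2 := by
  rw [Complex.inner, ← Complex.normSq_eq_norm_sq, Complex.normSq_apply]
  simp
  ring

/-- Since l(Bx) = μ l(x) + l'(x) with l' of smaller nilpotency order, |l|² grows at rate Re μ up to
the cross term ⟨l, l'⟩. A large multiple of the form controlling l', taken with growth rate halfway
between δ and Re μ, absorbs that term. -/
theorem isControlled_of_pow_apply_eq_zero [FiniteDimensional ℝ E] (B : E →ₗ[ℝ] E) {μ : ℂ} (K : ℕ) {δ : ℝ} (hδ : δ < μ.re)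
    (l : E →ₗ[ℝ] ℂ) (hl : ((complexDualMap B - algebraMap ℂ _ μ) ^ K) l = 0) :
    IsControlled B δ l := by
  induction K generalizing l δ with
  | zero =>
    rw [pow_zero, Module.End.one_apply] at hl
    exact hl ▸ .zero B δ
  | succ K ih =>
    rw [pow_succ, Module.End.mul_apply] at hl
    set l' := (complexDualMap B - algebraMap ℂ _ μ) l with hl'
    obtain ⟨b, C, hC, hs, hp, hb, hg⟩ :=
      ih (δ := (δ + μ.re) / 2) (by linarith) l' hl
    have hlB : ∀ x, l (B x) = μ * l x + l' x := fun x => by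
      rw [hl', LinearMap.sub_apply, Module.algebraMap_end_apply]
      simp [complexDualMap]
    set η := μ.re - δ with hη
    have hη0 : 0 < η := by linarith
    let lc : E →L[ℝ] ℂ := LinearMap.toContinuousLinearMap l
    -- The surplus rates over δ are η for |l|² and η/2 for b. As |l'|² ≤ C b, one has |l||l'| ≤
    -- η|l|² + |l'|²/(4η) ≤ η|l|² + R(η/2) b exactly for this R.
    let R := C / (2 * η ^ 2)
    have hR : 0 < R := by positivity
    let b₁ : E →L[ℝ] E →L[ℝ] ℝ := (innerSL ℝ (E := ℂ)).bilinearComp lc lc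
    have hb₁ : ∀ x y, b₁ x y = inner ℝ (l x) (l y) := fun x y => rfl
    have hval : ∀ x y, (R • b + b₁) x y = R * b x y + inner ℝ (l x) (l y) := fun x y => by
      rw [← hb₁]; rfl
    refine ⟨R • b + b₁, 1, one_pos, fun x y => ?_, fun x => ?_, fun x => ?_, fun x => ?_⟩
    · rw [hval, hval, hs, real_inner_comm]
    · rw [hval, real_inner_self_eq_norm_sq]
      have := hp x
      positivity
    · rw [hval, real_inner_self_eq_norm_sq]
      have := mul_nonneg hR.le (hp x)
      linarith
    · rw [hval, hval, real_inner_self_eq_norm_sq, hlB, inner_add_right, inner_mul_self]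
      have h1 : -(‖l x‖ * ‖l' x‖) ≤ inner ℝ (l x) (l' x) :=
        (abs_le.mp (abs_real_inner_le_norm _ _)).1
      have h2 : R * ((δ + μ.re) / 2 * b x x) ≤ R * b x (B x) :=
        mul_le_mul_of_nonneg_left (hg x) hR.le
      have h3 : ‖l' x‖ ^ 2 ≤ 2 * η ^ 2 * R * b x x := by
        refine (hb x).trans_eq ?_
        simp only [R]
        field_simp
      have h4 : ‖l x‖ * ‖l' x‖ ≤ η * ‖l x‖ ^ 2 + R * (η / 2) * b x x := by
        have h5 : η * (‖l x‖ * ‖l' x‖) ≤ η * (η * ‖l x‖ ^ 2 + R * (η / 2) * b x x) := by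
          nlinarith [sq_nonneg (2 * η * ‖l x‖ - ‖l' x‖)]
        exact le_of_mul_le_mul_left h5 hη0
      have h6 : δ = μ.re - η := by rw [hη]; ring
      rw [h6] at h2 ⊢
      nlinarith

/-- Generalized eigenvectors of the transpose span the complexified dual, and `IsControlled` is
additive. -/
theorem isControlled_of_forall_lt_re [FiniteDimensional ℝ E] (B : E →ₗ[ℝ] E) {δ : ℝ}
    (hδ : ∀ μ ∈ complexEigenvalues B, δ < μ.re) (l : E →ₗ[ℝ] ℂ) : IsControlled B δ l := by
  have hl : l ∈ ⨆ μ, (complexDualMap B).maxGenEigenspace μ := by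
    rw [Module.End.iSup_maxGenEigenspace_eq_top]; trivial
  induction hl using Submodule.iSup_induction' with
  | zero => exact .zero B δ
  | add x y _ _ hx hy => exact hx.add hy
  | mem μ x hx =>
    by_cases hx0 : x = 0
    · exact hx0 ▸ .zero B δ
    · obtain ⟨k, hk⟩ := (Module.End.mem_maxGenEigenspace _ _ _).mp hx
      refine isControlled_of_pow_apply_eq_zero B k (hδ μ ?_) x
        (by rwa [← Algebra.algebraMap_eq_smul_one] at hk)
      refine mem_complexEigenvalues_of_complexDualMap B ?_
      refine Module.End.hasEigenvalue_of_hasGenEigenvalue (k := k) ?_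
      rw [Module.End.hasGenEigenvalue_iff]
      exact (Submodule.ne_bot_iff _).mpr ⟨x, (Module.End.mem_genEigenspace_nat).mpr hk, hx0⟩

/-- A Lyapunov form for a linear map all of whose eigenvalues have positive real part. -/
theorem exists_lyapunov_form {n : ℕ}
    (B : EuclideanSpace ℝ (Fin n) →L[ℝ] EuclideanSpace ℝ (Fin n))
    (hB : ∀ μ ∈ complexEigenvalues (B : EuclideanSpace ℝ (Fin n) →ₗ[ℝ] EuclideanSpace ℝ (Fin n)),
      0 < μ.re) :
    ∃ (b : EuclideanSpace ℝ (Fin n) →L[ℝ] EuclideanSpace ℝ (Fin n) →L[ℝ] ℝ) (m ε : ℝ), 0 < m ∧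
      0 < ε ∧ (∀ x y, b x y = b y x) ∧ (∀ x, m * ‖x‖ ^ 2 ≤ b x x) ∧
      ∀ x, ε * b x x ≤ b x (B x) := by
  obtain ⟨ε, hε, hlt⟩ : ∃ ε : ℝ, 0 < ε ∧ ∀ μ ∈ complexEigenvalues
      (B : EuclideanSpace ℝ (Fin n) →ₗ[ℝ] EuclideanSpace ℝ (Fin n)), ε < μ.re := by
    generalize complexEigenvalues (B : EuclideanSpace ℝ (Fin n) →ₗ[ℝ] EuclideanSpace ℝ (Fin n)) = s
      at hB
    induction s using Multiset.induction with
    | empty => exact ⟨1, one_pos, by simp⟩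
    | cons a s ih =>
      obtain ⟨ε, hε, h⟩ := ih fun μ hμ => hB μ (Multiset.mem_cons_of_mem hμ)
      have ha := hB a (Multiset.mem_cons_self a s)
      refine ⟨min ε (a.re / 2), by positivity, fun μ hμ => ?_⟩
      rcases Multiset.mem_cons.mp hμ with rfl | hμ
      · exact (min_le_right _ _).trans_lt (by linarith)
      · exact (min_le_left _ _).trans_lt (h μ hμ)
  -- Adding the semidefinite forms that control the coordinate functionals gives a definite form.
  let l : Fin n → EuclideanSpace ℝ (Fin n) →ₗ[ℝ] ℂ := fun i =>
    Complex.ofRealCLM.toLinearMap ∘ₗ (EuclideanSpace.proj i : EuclideanSpace ℝ (Fin n) →L[ℝ] ℝ)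
  choose b C hC hs hp hl hg using fun i => isControlled_of_forall_lt_re _ hlt (l i)
  have hsum : ∀ x y, (∑ i, b i) x y = ∑ i, b i x y := fun x y => by simp
  have hCs : 0 ≤ ∑ i, C i := Finset.sum_nonneg fun i _ => (hC i).le
  refine ⟨∑ i, b i, (∑ i, C i + 1)⁻¹, ε, by positivity, hε, fun x y => ?_, fun x => ?_,
    fun x => ?_⟩
  · rw [hsum, hsum]
    exact Finset.sum_congr rfl fun i _ => hs i x y
  · rw [hsum, inv_mul_le_iff₀ (by positivity), EuclideanSpace.norm_sq_eq, add_mul, one_mul,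
      Finset.sum_mul]
    have h2 : 0 ≤ ∑ i, b i x x := Finset.sum_nonneg fun i _ => hp i x
    refine le_trans (Finset.sum_le_sum fun i _ => ?_) (le_add_of_nonneg_right h2)
    have h1 := hl i x
    have h3 : ‖l i x‖ = ‖x i‖ := by simp [l]
    rw [h3] at h1
    refine h1.trans (mul_le_mul_of_nonneg_left ?_ (hC i).le)
    exact Finset.single_le_sum (f := fun i => b i x x) (fun i _ => hp i x) (Finset.mem_univ i)
  · rw [hsum, hsum, Finset.mul_sum]
    exact Finset.sum_le_sum fun i _ => hg i x

end Lyapunov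

/-! ### Order of vanishing and Taylor estimates -/

section VanishesToOrder

universe u

variable {E : Type} {F : Type u} {G H : Type*} [NormedAddCommGroup E] [NormedSpace ℝ E]
  [NormedAddCommGroup F]
  [NormedSpace ℝ F] [NormedAddCommGroup G] [NormedSpace ℝ G] [NormedAddCommGroup H]
  [NormedSpace ℝ H]

/-- All derivatives of `f` of order `< k` vanish at the origin. -/
def VanishesToOrder (k : ℕ) (f : E → F) : Prop := ∀ j < k, iteratedFDeriv ℝ j f 0 = 0

theorem VanishesToOrder.mono {k l : ℕ} (h : k ≤ l) {f : E → F} (hf : VanishesToOrder l f) :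
    VanishesToOrder k f := fun j hj => hf j (hj.trans_le h)

theorem vanishesToOrder_zero (f : E → F) : VanishesToOrder 0 f := fun _ h => absurd h (by omega)

theorem iteratedFDeriv_zero_eq_zero_iff {f : E → F} {x : E} :
    iteratedFDeriv ℝ 0 f x = 0 ↔ f x = 0 := by
  rw [← norm_eq_zero, norm_iteratedFDeriv_zero, norm_eq_zero]

theorem vanishesToOrder_succ_iff {k : ℕ} {f : E → F} :
    VanishesToOrder (k + 1) f ↔ f 0 = 0 ∧ VanishesToOrder k (fderiv ℝ f) := by
  have key : ∀ j, iteratedFDeriv ℝ (j + 1) f 0 = 0 ↔ iteratedFDeriv ℝ j (fderiv ℝ f) 0 = 0 :=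
    fun j => by rw [← norm_eq_zero, ← norm_iteratedFDeriv_fderiv, norm_eq_zero]
  constructor
  · exact fun h => ⟨iteratedFDeriv_zero_eq_zero_iff.mp (h 0 (by omega)),
      fun j hj => (key j).mp (h (j + 1) (by omega))⟩
  · rintro ⟨h0, h⟩ j hj
    cases j with
    | zero => exact iteratedFDeriv_zero_eq_zero_iff.mpr h0
    | succ j => exact (key j).mpr (h j (by omega))

theorem VanishesToOrder.fderiv {k : ℕ} {f : E → F} (h : VanishesToOrder (k + 1) f) :
    VanishesToOrder k (fderiv ℝ f) := (vanishesToOrder_succ_iff.mp h).2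

theorem VanishesToOrder.congr {k : ℕ} {f g : E → F} (hf : VanishesToOrder k f)
    (h : f =ᶠ[𝓝 0] g) : VanishesToOrder k g := fun j hj => by
  rw [← hf j hj]
  exact (h.symm.iteratedFDeriv ℝ j).self_of_nhds

theorem VanishesToOrder.add {k : ℕ} {f g : E → F} (hf : VanishesToOrder k f)
    (hg : VanishesToOrder k g) (hfs : ContDiffAt ℝ ∞ f 0) (hgs : ContDiffAt ℝ ∞ g 0) :
    VanishesToOrder k (fun y => f y + g y) := fun j hj => by
  have h := iteratedFDeriv_add_apply (i := j) (f := f) (g := g)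
    (hfs.of_le (by exact_mod_cast le_top)) (hgs.of_le (by exact_mod_cast le_top))
  rw [hf j hj, hg j hj, add_zero] at h
  exact h

theorem VanishesToOrder.clm_apply_left {k : ℕ} {f : E → F} (hf : VanishesToOrder k f)
    (hfs : ∀ j < k, ContDiffAt ℝ j f 0) (L : F →L[ℝ] G) :
    VanishesToOrder k (fun y => L (f y)) := fun j hj => by
  have h := L.iteratedFDeriv_comp_left (hfs j hj) (i := j) le_rfl
  rw [hf j hj] at h
  refine h.trans ?_
  ext
  simp

theorem VanishesToOrder.neg {k : ℕ} {f : E → F} (hf : VanishesToOrder k f)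
    (hfs : ContDiffAt ℝ ∞ f 0) : VanishesToOrder k (fun y => -f y) :=
  hf.clm_apply_left (fun _ _ => hfs.of_le (by exact_mod_cast le_top)) (-ContinuousLinearMap.id ℝ F)

theorem VanishesToOrder.sub {k : ℕ} {f g : E → F} (hf : VanishesToOrder k f)
    (hg : VanishesToOrder k g) (hfs : ContDiffAt ℝ ∞ f 0) (hgs : ContDiffAt ℝ ∞ g 0) :
    VanishesToOrder k (fun y => f y - g y) := by
  simp only [sub_eq_add_neg]
  exact hf.add (hg.neg hgs) hfs hgs.neg

/-- In each Leibniz term of total order j < k + l, either f is differentiated fewer than k times or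
g fewer than l times. -/
theorem VanishesToOrder.bilinear {U : Set E} (hU : IsOpen U) (h0 : (0 : E) ∈ U) {k l : ℕ}
    {f : E → F} {g : E → G} (hf : VanishesToOrder k f) (hg : VanishesToOrder l g)
    (hfs : ContDiffOn ℝ ∞ f U) (hgs : ContDiffOn ℝ ∞ g U) (b : F →L[ℝ] G →L[ℝ] H) :
    VanishesToOrder (k + l) (fun y => b (f y) (g y)) := fun j hj => by
  have hb := b.norm_iteratedFDerivWithin_le_of_bilinear hfs hgs hU.uniqueDiffOn h0
    (n := j) (by exact_mod_cast le_top)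
  rw [Finset.sum_eq_zero, mul_zero, iteratedFDerivWithin_of_isOpen j hU h0] at hb
  · exact norm_le_zero_iff.mp hb
  · intro i hi
    have hi' := Finset.mem_range.mp hi
    rw [iteratedFDerivWithin_of_isOpen i hU h0, iteratedFDerivWithin_of_isOpen (j - i) hU h0]
    by_cases hik : i < k
    · rw [hf i hik]; simp
    · rw [hg (j - i) (by omega)]; simp

theorem VanishesToOrder.clm_apply {U : Set E} (hU : IsOpen U) (h0 : (0 : E) ∈ U) {k l : ℕ}
    {f : E → F →L[ℝ] G} {g : E → F} (hf : VanishesToOrder k f) (hg : VanishesToOrder l g)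
    (hfs : ContDiffOn ℝ ∞ f U) (hgs : ContDiffOn ℝ ∞ g U) :
    VanishesToOrder (k + l) (fun y => f y (g y)) :=
  hf.bilinear hU h0 hg hfs hgs (ContinuousLinearMap.id ℝ _)

theorem ContDiffOn.fderiv_infty {U : Set E} (hU : IsOpen U) {f : E → F}
    (hf : ContDiffOn ℝ ∞ f U) : ContDiffOn ℝ ∞ (fderiv ℝ f) U :=
  hf.fderiv_of_isOpen hU (by simp)

theorem ContDiffOn.differentiableAt_infty {U : Set E} (hU : IsOpen U) {f : E → F}
    (hf : ContDiffOn ℝ ∞ f U) {y : E} (hy : y ∈ U) : DifferentiableAt ℝ f y :=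
  (hf.contDiffAt (hU.mem_nhds hy)).differentiableAt (by simp)

theorem VanishesToOrder.exists_norm_le_nhds {U : Set E} (hU : IsOpen U) (h0 : (0 : E) ∈ U) {k : ℕ}
    {f : E → F} (hf : VanishesToOrder k f) (hfs : ContDiffOn ℝ ∞ f U) :
    ∃ r > 0, ∃ C : ℝ, 0 ≤ C ∧ ∀ y : E, ‖y‖ < r → ‖f y‖ ≤ C * ‖y‖ ^ k := by
  obtain ⟨r₀, hr₀, hrU⟩ := Metric.isOpen_iff.mp hU 0 h0
  induction k generalizing F with
  | zero =>
    have hc : ContinuousAt f 0 := (hfs.contDiffAt (hU.mem_nhds h0)).continuousAt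
    obtain ⟨r, hr, h⟩ := Metric.continuousAt_iff.mp hc 1 one_pos
    refine ⟨r, hr, ‖f 0‖ + 1, by positivity, fun y hy => ?_⟩
    have h1 := h (x := y) (by simpa using hy)
    rw [dist_eq_norm] at h1
    have h2 : ‖f y‖ ≤ ‖f y - f 0‖ + ‖f 0‖ := norm_le_norm_sub_add _ _
    rw [pow_zero, mul_one]
    linarith
  | succ k ih =>
    obtain ⟨r, hr, C, hC, h⟩ := ih hf.fderiv (hfs.fderiv_infty hU)
    refine ⟨min r r₀, by positivity, C, hC, fun y hy => ?_⟩
    have hball : ∀ z ∈ Metric.closedBall (0 : E) ‖y‖, ‖z‖ ≤ ‖y‖ := fun z hz => by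
      simpa using hz
    have := (convex_closedBall (0 : E) ‖y‖).norm_image_sub_le_of_norm_fderiv_le (𝕜 := ℝ) (f := f)
      (C := C * ‖y‖ ^ k) (x := 0) (y := y)
      (fun z hz => hfs.differentiableAt_infty hU (hrU (by
        simpa using ((hball z hz).trans_lt hy).trans_le (min_le_right _ _))))
      (fun z hz => (h z (((hball z hz).trans_lt hy).trans_le (min_le_left _ _))).trans (by
        gcongr
        exact hball z hz)) (by simp) (by simp)
    rw [(vanishesToOrder_succ_iff.mp hf).1, sub_zero, sub_zero] at this
    rwa [pow_succ, ← mul_assoc]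

theorem VanishesToOrder.exists_norm_le_of_isCompact {U : Set E} (hU : IsOpen U)
    (h0 : (0 : E) ∈ U) {k : ℕ} {f : E → F} (hf : VanishesToOrder k f) (hfs : ContDiffOn ℝ ∞ f U)
    {Z : Set E} (hZ : IsCompact Z) (hZU : Z ⊆ U) :
    ∃ C : ℝ, 0 ≤ C ∧ ∀ y ∈ Z, ‖f y‖ ≤ C * ‖y‖ ^ k := by
  obtain ⟨r, hr, C, hC, h⟩ := hf.exists_norm_le_nhds hU h0 hfs
  obtain ⟨C', hC'⟩ := hZ.exists_bound_of_continuousOn (hfs.continuousOn.mono hZU)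
  -- C serves near the origin; for ‖y‖ ≥ r the bound C' on Z is at most (|C'| / r^k)‖y‖^k.
  refine ⟨C + |C'| / r ^ k, by positivity, fun y hy => ?_⟩
  rw [add_mul]
  by_cases hyr : ‖y‖ < r
  · exact (h y hyr).trans (le_add_of_nonneg_right (by positivity))
  · refine le_trans ?_ (le_add_of_nonneg_left (by positivity))
    rw [div_mul_eq_mul_div, le_div_iff₀ (by positivity)]
    have h1 : ‖f y‖ ≤ |C'| := (hC' y hy).trans (le_abs_self _)
    have h2 : r ^ k ≤ ‖y‖ ^ k := pow_le_pow_left₀ hr.le (not_lt.mp hyr) k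
    exact mul_le_mul h1 h2 (by positivity) (abs_nonneg _)

/-- A second order Taylor estimate, uniform on compact sets and with the weight that comes from the
vanishing of `f` at the origin. -/
theorem VanishesToOrder.exists_taylor_le [ProperSpace E] {U : Set E} (hU : IsOpen U)
    (h0 : (0 : E) ∈ U) {k : ℕ} {f : E → F} (hf : VanishesToOrder (k + 2) f)
    (hfs : ContDiffOn ℝ ∞ f U) {Z : Set E} (hZ : IsCompact Z) (hZU : Z ⊆ U) :
    ∃ δ > 0, ∃ C : ℝ, 0 ≤ C ∧ ∀ x ∈ Z, ∀ y, ‖y - x‖ ≤ δ →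
      ‖f y - f x - _root_.fderiv ℝ f x (y - x)‖ ≤
        C * (‖x‖ + ‖y - x‖) ^ k * ‖y - x‖ ^ 2 := by
  -- Z need not be convex, but a closed thickening is still compact in U and contains balls around
  -- the points of Z, on which the mean value inequality applies twice.
  obtain ⟨δ, hδ, hδU⟩ := hZ.exists_cthickening_subset_open hU hZU
  obtain ⟨C, hC, hb⟩ := hf.fderiv.fderiv.exists_norm_le_of_isCompact hU h0
    ((hfs.fderiv_infty hU).fderiv_infty hU) hZ.cthickening hδU
  refine ⟨δ, hδ, C, hC, fun x hx y hy => ?_⟩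
  have hsub : Metric.closedBall x ‖y - x‖ ⊆ Metric.cthickening δ Z :=
    (Metric.closedBall_subset_closedBall hy).trans (Metric.closedBall_subset_cthickening hx δ)
  have hx' : x ∈ Metric.closedBall x ‖y - x‖ := by simp
  have hy' : y ∈ Metric.closedBall x ‖y - x‖ := by simp [dist_eq_norm]
  have hle : ∀ z ∈ Metric.closedBall x ‖y - x‖, ‖z - x‖ ≤ ‖y - x‖ := fun z hz => by
    simpa [dist_eq_norm] using hz
  have h1 : ∀ z ∈ Metric.closedBall x ‖y - x‖,
      ‖_root_.fderiv ℝ f z - _root_.fderiv ℝ f x‖ ≤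
        C * (‖x‖ + ‖y - x‖) ^ k * ‖y - x‖ := fun z hz => by
    refine ((convex_closedBall x _).norm_image_sub_le_of_norm_fderiv_le (𝕜 := ℝ)
      (fun z hz => (hfs.fderiv_infty hU).differentiableAt_infty hU (hδU (hsub hz)))
      (fun z hz => (hb z (hsub hz)).trans ?_) hx' hz).trans
      (mul_le_mul_of_nonneg_left (hle z hz) (by positivity))
    gcongr
    calc ‖z‖ = ‖x + (z - x)‖ := by congr 1; abel
      _ ≤ ‖x‖ + ‖z - x‖ := norm_add_le _ _
      _ ≤ _ := by gcongr; exact hle z hz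
  rw [pow_two, ← mul_assoc]
  exact (convex_closedBall x _).norm_image_sub_le_of_norm_fderiv_le' (𝕜 := ℝ)
      (fun z hz => hfs.differentiableAt_infty hU (hδU (hsub hz))) h1 hx' hy'

theorem ContDiffOn.exists_taylor_le [ProperSpace E] {U : Set E} (hU : IsOpen U)
    {f : E → F} (hfs : ContDiffOn ℝ ∞ f U) {Z : Set E} (hZ : IsCompact Z) (hZU : Z ⊆ U) :
    ∃ δ > 0, ∃ C : ℝ, 0 ≤ C ∧ ∀ x ∈ Z, ∀ y, ‖y - x‖ ≤ δ →
      ‖f y - f x - fderiv ℝ f x (y - x)‖ ≤ C * ‖y - x‖ ^ 2 := by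
  obtain ⟨δ, hδ, hδU⟩ := hZ.exists_cthickening_subset_open hU hZU
  obtain ⟨C, hb⟩ := (hZ.cthickening (r := δ)).exists_bound_of_continuousOn
    (((hfs.fderiv_infty hU).fderiv_infty hU).continuousOn.mono hδU)
  refine ⟨δ, hδ, |C|, abs_nonneg C, fun x hx y hy => ?_⟩
  have hsub : Metric.closedBall x ‖y - x‖ ⊆ Metric.cthickening δ Z :=
    (Metric.closedBall_subset_closedBall hy).trans (Metric.closedBall_subset_cthickening hx δ)
  have hx' : x ∈ Metric.closedBall x ‖y - x‖ := by simp
  have hy' : y ∈ Metric.closedBall x ‖y - x‖ := by simp [dist_eq_norm]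
  have h1 : ∀ z ∈ Metric.closedBall x ‖y - x‖,
      ‖_root_.fderiv ℝ f z - _root_.fderiv ℝ f x‖ ≤ |C| * ‖y - x‖ := fun z hz =>
    ((convex_closedBall x _).norm_image_sub_le_of_norm_fderiv_le (𝕜 := ℝ)
      (fun z hz => (hfs.fderiv_infty hU).differentiableAt_infty hU (hδU (hsub hz)))
      (fun z hz => (hb z (hsub hz)).trans (le_abs_self C)) hx' hz).trans
      (mul_le_mul_of_nonneg_left (by simpa [dist_eq_norm] using hz) (abs_nonneg C))
  rw [pow_two, ← mul_assoc]
  exact (convex_closedBall x _).norm_image_sub_le_of_norm_fderiv_le' (𝕜 := ℝ)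
      (fun z hz => hfs.differentiableAt_infty hU (hδU (hsub hz))) h1 hx' hy'

theorem ContDiffOn.exists_lipschitz_le [ProperSpace E] {U : Set E} (hU : IsOpen U)
    {f : E → F} (hfs : ContDiffOn ℝ ∞ f U) {Z : Set E} (hZ : IsCompact Z) (hZU : Z ⊆ U) :
    ∃ δ > 0, ∃ C : ℝ, 0 ≤ C ∧ ∀ x ∈ Z, ∀ y, ‖y - x‖ ≤ δ → ‖f y - f x‖ ≤ C * ‖y - x‖ := by
  obtain ⟨δ, hδ, hδU⟩ := hZ.exists_cthickening_subset_open hU hZU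
  obtain ⟨C, hb⟩ := (hZ.cthickening (r := δ)).exists_bound_of_continuousOn
    ((hfs.fderiv_infty hU).continuousOn.mono hδU)
  refine ⟨δ, hδ, |C|, abs_nonneg C, fun x hx y hy => ?_⟩
  have hsub : Metric.closedBall x ‖y - x‖ ⊆ Metric.cthickening δ Z :=
    (Metric.closedBall_subset_closedBall hy).trans (Metric.closedBall_subset_cthickening hx δ)
  exact (convex_closedBall x _).norm_image_sub_le_of_norm_fderiv_le (𝕜 := ℝ)
      (fun z hz => hfs.differentiableAt_infty hU (hδU (hsub hz)))
      (fun z hz => (hb z (hsub hz)).trans (le_abs_self C)) (by simp) (by simp [dist_eq_norm])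

end VanishesToOrder

/-! ### Formal injectivity in nonresonant degrees -/

section FormalInjectivity

universe u

variable {E : Type} [NormedAddCommGroup E] [NormedSpace ℝ E]

theorem ContDiffOn.homOp {V : Type u} [NormedAddCommGroup V] [NormedSpace ℝ V] {U : Set E}
    {A : E → V →L[ℝ] V} (hA : ContDiffOn ℝ ∞ A U) {B : E → E →L[ℝ] E} (hB : ContDiffOn ℝ ∞ B U) :
    ContDiffOn ℝ ∞ (fun y => homOp (A y) (B y)) U := by
  have h₁ : ContDiff ℝ ∞ fun f : V →L[ℝ] V => ContinuousLinearMap.compL ℝ E V V f :=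
    ContinuousLinearMap.contDiff _
  have h₂ : ContDiff ℝ ∞ fun f : E →L[ℝ] E => (ContinuousLinearMap.compL ℝ E E V).flip f :=
    ContinuousLinearMap.contDiff _
  exact (h₁.comp_contDiffOn hA).add (h₂.comp_contDiffOn hB)

/-- Symmetry of the second derivative turns D(Du[X]) into D(Du)[X] + Du∘DX. So Du satisfies a
transport equation with coefficient `homOp A DX`, up to a term without derivatives of u. This drives
the induction on the order of vanishing and dictates `prolongCoeff`. -/
theorem fderiv_transport {V : Type u} [NormedAddCommGroup V] [NormedSpace ℝ V] {U : Set E}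
    (hU : IsOpen U) {X : E → E} (hX : ContDiffOn ℝ ∞ X U) {A : E → V →L[ℝ] V}
    (hA : ContDiffOn ℝ ∞ A U) {u : E → V} (hu : ContDiffOn ℝ ∞ u U) {y : E} (hy : y ∈ U) :
    fderiv ℝ (fun y => fderiv ℝ u y (X y) + A y (u y)) y =
      fderiv ℝ (fderiv ℝ u) y (X y) + homOp (A y) (fderiv ℝ X y) (fderiv ℝ u y) +
        (fderiv ℝ A y).flip (u y) := by
  have hDu := (hu.fderiv_infty hU).differentiableAt_infty hU hy
  have hX' := hX.differentiableAt_infty hU hy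
  have hA' := hA.differentiableAt_infty hU hy
  have hu' := hu.differentiableAt_infty hU hy
  rw [fderiv_fun_add (hDu.clm_apply hX') (hA'.clm_apply hu'), fderiv_clm_apply hDu hX',
    fderiv_clm_apply hA' hu']
  ext h
  have hsymm := (hu.contDiffAt (hU.mem_nhds hy)).isSymmSndFDerivAt
    (by simp; norm_cast) h (X y)
  simp [hsymm]
  abel

/-- If `(D_X + A) u` vanishes to one order more than `u`, then `u` vanishes to one order more. -/
theorem VanishesToOrder.succ_of_transport {V : Type u} [NormedAddCommGroup V] [NormedSpace ℝ V]
    {U : Set E} (hU : IsOpen U) (h0 : (0 : E) ∈ U) {X : E → E} (hX : ContDiffOn ℝ ∞ X U)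
    (hX0 : X 0 = 0) {A : E → V →L[ℝ] V} (hA : ContDiffOn ℝ ∞ A U) {k : ℕ}
    (hk : NonresonantAt (_root_.fderiv ℝ X 0) k (A 0)) {u : E → V} (hu : ContDiffOn ℝ ∞ u U)
    (hv : VanishesToOrder k u)
    (hv' : VanishesToOrder (k + 1) (fun y => _root_.fderiv ℝ u y (X y) + A y (u y))) :
    VanishesToOrder (k + 1) u := by
  induction k generalizing V with
  | zero =>
    refine vanishesToOrder_succ_iff.mpr ⟨?_, vanishesToOrder_zero _⟩
    have := (vanishesToOrder_succ_iff.mp hv').1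
    rw [hX0, map_zero, zero_add] at this
    exact (injective_iff_map_eq_zero (A 0)).mp hk _ this
  | succ k ih =>
    refine vanishesToOrder_succ_iff.mpr ⟨(vanishesToOrder_succ_iff.mp hv).1, ?_⟩
    have hDX := hX.fderiv_infty hU
    have hDA := hA.fderiv_infty hU
    have hDu := hu.fderiv_infty hU
    -- Apply the induction hypothesis to Du, with values in Hom(E, V). The extra term (DA)u already
    -- vanishes to order k + 1 because u does, so it may be moved to the right-hand side.
    refine ih (hA.homOp hDX) hk hDu hv.fderiv ?_
    have hT : ContDiffOn ℝ ∞ (fun y => _root_.fderiv ℝ u y (X y) + A y (u y)) U :=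
      (hDu.clm_apply hX).add (hA.clm_apply hu)
    let Φ : (E →L[ℝ] V →L[ℝ] V) →L[ℝ] V →L[ℝ] E →L[ℝ] V :=
      (ContinuousLinearMap.flipₗᵢ ℝ E V V).toContinuousLinearEquiv.toContinuousLinearMap
    have hAu : VanishesToOrder (k + 1) (fun y => Φ (_root_.fderiv ℝ A y) (u y)) := by
      have := (vanishesToOrder_zero (_root_.fderiv ℝ A)).bilinear hU h0 hv hDA hu Φ
      rwa [zero_add] at this
    have hAus : ContDiffOn ℝ ∞ (fun y => Φ (_root_.fderiv ℝ A y) (u y)) U := by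
      have h₁ : ContDiff ℝ ∞ fun f => Φ f :=
        ContinuousLinearMap.contDiff _
      exact (h₁.comp_contDiffOn hDA).clm_apply hu
    refine (hv'.fderiv.sub hAu ((hT.fderiv_infty hU).contDiffAt (hU.mem_nhds h0))
      (hAus.contDiffAt (hU.mem_nhds h0))).congr ?_
    filter_upwards [hU.mem_nhds h0] with y hy
    rw [fderiv_transport hU hX hA hu hy]
    simp [Φ]

end FormalInjectivity

/-! ### Trajectories of the reversed field -/

section ReversedCurves

variable {E : Type} [NormedAddCommGroup E] [NormedSpace ℝ E]

/-- `σ` is an integral curve of `-X` on `[0, ∞)`. -/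
def IsReversedCurve (X : E → E) (σ : ℝ → E) : Prop :=
  ∀ s, 0 ≤ s → HasDerivWithinAt σ (-X (σ s)) (Set.Ici 0) s

theorem IsReversedCurve.right {X : E → E} {σ : ℝ → E} (h : IsReversedCurve X σ) {s : ℝ}
    (hs : 0 ≤ s) : HasDerivWithinAt σ (-X (σ s)) (Set.Ici s) s :=
  (h s hs).mono (Set.Ici_subset_Ici.mpr hs)

theorem IsReversedCurve.continuousOn {X : E → E} {σ : ℝ → E} (h : IsReversedCurve X σ) :
    ContinuousOn σ (Set.Ici 0) := fun s hs => (h s hs).continuousWithinAt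

theorem isReversedCurve_zero {X : E → E} (hX0 : X 0 = 0) : IsReversedCurve X fun _ => 0 :=
  fun s _ => by simpa [hX0] using hasDerivWithinAt_const s (Set.Ici 0) (0 : E)

theorem hasDerivWithinAt_form {b : E →L[ℝ] E →L[ℝ] ℝ} (hb : ∀ x y, b x y = b y x)
    {f : ℝ → E} {f' : E} {S : Set ℝ} {s : ℝ} (hf : HasDerivWithinAt f f' S s) :
    HasDerivWithinAt (fun t => b (f t) (f t)) (2 * b (f s) f') S s := by
  have h1 : HasDerivWithinAt (fun t => b (f t)) (b f') S s :=
    b.hasFDerivAt.comp_hasDerivWithinAt s hf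
  have h2 := h1.clm_apply hf
  rwa [hb f' (f s), ← two_mul] at h2

/-- Contraction of a sublevel set of a Lyapunov form under the reversed flow. -/
theorem form_le_of_isReversedCurve {b : E →L[ℝ] E →L[ℝ] ℝ} (hb : ∀ x y, b x y = b y x)
    {X : E → E} (hX0 : X 0 = 0) {κ ε : ℝ} (hκ : 0 < κ) (hε : 0 < ε)
    (h : ∀ x y, b x x ≤ κ → b y y ≤ κ → ε * b (x - y) (x - y) ≤ b (x - y) (X x - X y))
    {σ τ : ℝ → E} (hσ : IsReversedCurve X σ) (hτ : IsReversedCurve X τ) {T : ℝ} (hT : 0 ≤ T)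
    (hσT : b (σ T) (σ T) ≤ κ) (hτT : b (τ T) (τ T) ≤ κ) {s : ℝ} (hs : T ≤ s) :
    b (σ s - τ s) (σ s - τ s) ≤
      Real.exp (-(2 * ε * (s - T))) * b (σ T - τ T) (σ T - τ T) := by
  -- The sublevel set is forward invariant: where b(ρ, ρ) = κ, comparison with the rest point 0
  -- gives a derivative of at most -2εκ < 0.
  have hinv : ∀ {ρ : ℝ → E}, IsReversedCurve X ρ → b (ρ T) (ρ T) ≤ κ →
      ∀ s, T ≤ s → b (ρ s) (ρ s) ≤ κ := by
    intro ρ hρ hρT s hs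
    have hsub : Set.Icc T s ⊆ Set.Ici 0 := fun t ht => hT.trans ht.1
    refine image_le_of_deriv_right_lt_deriv_boundary (f := fun t => b (ρ t) (ρ t)) (a := T) (b := s)
      (f' := fun t => 2 * b (ρ t) (-X (ρ t))) (B := fun _ => κ) (B' := fun _ => 0) ?_ ?_ hρT
      (fun t => hasDerivAt_const t κ) ?_ ⟨hs, le_rfl⟩
    · exact ((b.continuous.comp_continuousOn hρ.continuousOn).clm_apply hρ.continuousOn).mono hsub
    · exact fun t ht => hasDerivWithinAt_form hb (hρ.right (hT.trans ht.1))
    · intro t ht heq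
      have h1 := h (ρ t) 0 heq.le (by simpa using hκ.le)
      rw [hX0, sub_zero, sub_zero, heq] at h1
      rw [map_neg]
      have : 0 < ε * κ := mul_pos hε hκ
      linarith
  have hsub : Set.Icc T s ⊆ Set.Ici 0 := fun t ht => hT.trans ht.1
  have hd : ContinuousOn (fun t => σ t - τ t) (Set.Icc T s) :=
    (hσ.continuousOn.sub hτ.continuousOn).mono hsub
  -- While both curves stay in the sublevel set, e^(2ε(t-T)) b(σ - τ, σ - τ) is nonincreasing.
  have key := image_le_of_deriv_right_le_deriv_boundary
    (f := fun t => Real.exp (2 * ε * (t - T)) * b (σ t - τ t) (σ t - τ t)) (a := T) (b := s)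
    (f' := fun t => Real.exp (2 * ε * (t - T)) * (2 * ε) * b (σ t - τ t) (σ t - τ t) +
      Real.exp (2 * ε * (t - T)) * (2 * b (σ t - τ t) (-X (σ t) - -X (τ t))))
    (B := fun _ => b (σ T - τ T) (σ T - τ T)) (B' := fun _ => 0) ?_ ?_ (by simp)
    (fun _ _ => continuousWithinAt_const) (fun t _ => hasDerivWithinAt_const t _ _) ?_
    (x := s) ⟨hs, le_rfl⟩
  · rw [Real.exp_neg, inv_mul_eq_div, le_div_iff₀ (Real.exp_pos _), mul_comm]
    exact key
  · refine ContinuousOn.mul (by fun_prop) ?_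
    exact (b.continuous.comp_continuousOn hd).clm_apply hd
  · intro t ht
    have ht0 := hT.trans ht.1
    refine HasDerivWithinAt.mul ?_ (hasDerivWithinAt_form hb ((hσ.right ht0).sub (hτ.right ht0)))
    have : HasDerivAt (fun t => 2 * ε * (t - T)) (2 * ε) t := by
      simpa using ((hasDerivAt_id t).sub_const T).const_mul (2 * ε)
    exact this.exp.hasDerivWithinAt
  · intro t ht
    have h1 := h _ _ (hinv hσ hσT t ht.1) (hinv hτ hτT t ht.1)
    have h2 : b (σ t - τ t) (-X (σ t) - -X (τ t)) = -b (σ t - τ t) (X (σ t) - X (τ t)) := by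
      rw [← map_neg]; congr 1; abel
    rw [h2]
    have := Real.exp_pos (2 * ε * (t - T))
    nlinarith

/-- Continuous dependence on the initial value over a finite time. -/
theorem IsReversedCurve.exists_norm_sub_le [ProperSpace E] {U : Set E} (hU : IsOpen U) {X : E → E}
    (hX : ContDiffOn ℝ ∞ X U) {σ : ℝ → E} (hσ : IsReversedCurve X σ)
    (hσU : ∀ s, 0 ≤ s → σ s ∈ U) (T : ℝ) (hT : 0 ≤ T) :
    ∃ δ > 0, ∃ C : ℝ, 1 ≤ C ∧ ∀ τ : ℝ → E, IsReversedCurve X τ → ‖τ 0 - σ 0‖ ≤ δ →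
      ∀ s, 0 ≤ s → s ≤ T → ‖τ s - σ s‖ ≤ C * ‖τ 0 - σ 0‖ := by
  have hZ : IsCompact (σ '' Set.Icc 0 T) :=
    isCompact_Icc.image_of_continuousOn (hσ.continuousOn.mono fun t ht => ht.1)
  have hZU : σ '' Set.Icc 0 T ⊆ U := by
    rintro _ ⟨t, ht, rfl⟩
    exact hσU t ht.1
  obtain ⟨δ₀, hδ₀, L, hL, hlip⟩ := hX.exists_lipschitz_le hU hZ hZU
  set C := Real.exp ((L + 1) * T) with hC
  have hC0 : 0 < C := Real.exp_pos _
  have hC1 : 1 ≤ C := Real.one_le_exp (by positivity)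
  -- A positive η in place of the initial distance, and the rate L + 1 > L, make the comparison
  -- strict. The barrier stays below δ₀, where the Lipschitz bound is available. Coinciding initial
  -- values are reached by letting η tend to 0, which includes uniqueness.
  have main : ∀ τ : ℝ → E, IsReversedCurve X τ → ∀ η : ℝ, 0 < η → η ≤ δ₀ / C →
      ‖τ 0 - σ 0‖ ≤ η → ∀ s, 0 ≤ s → s ≤ T → ‖τ s - σ s‖ ≤ C * η := by
    intro τ hτ η hη hηδ h0 s hs hsT
    have hsub : Set.Icc 0 s ⊆ Set.Ici (0 : ℝ) := fun t ht => ht.1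
    have hexp : ∀ t ≤ T, Real.exp ((L + 1) * t) ≤ C := fun t ht =>
      Real.exp_le_exp.mpr (mul_le_mul_of_nonneg_left ht (by linarith))
    have key := image_norm_le_of_norm_deriv_right_lt_deriv_boundary
      (f := fun t => τ t - σ t) (a := 0) (b := s) (f' := fun t => -X (τ t) - -X (σ t))
      (B := fun t => Real.exp ((L + 1) * t) * η)
      (B' := fun t => Real.exp ((L + 1) * t) * (L + 1) * η)
      ((hτ.continuousOn.sub hσ.continuousOn).mono hsub)
      (fun t ht => (hτ.right ht.1).sub (hσ.right ht.1)) (by simpa using h0)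
      (fun t => ?_) (fun t ht heq => ?_) (x := s) ⟨hs, le_rfl⟩
    · exact key.trans (mul_le_mul_of_nonneg_right (hexp s hsT) hη.le)
    · have : HasDerivAt (fun t => (L + 1) * t) (L + 1) t := by
        simpa using (hasDerivAt_id t).const_mul (L + 1)
      exact this.exp.mul_const η
    · have ht' : t ≤ T := ht.2.le.trans hsT
      have hle : ‖τ t - σ t‖ ≤ δ₀ := by
        rw [heq]
        calc _ ≤ C * (δ₀ / C) := mul_le_mul (hexp t ht') hηδ hη.le hC0.le
          _ = δ₀ := by field_simp
      have h1 := hlip (σ t) ⟨t, ⟨ht.1, ht'⟩, rfl⟩ (τ t) hle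
      have h2 : ‖-X (τ t) - -X (σ t)‖ = ‖X (τ t) - X (σ t)‖ := by
        rw [← norm_neg]; congr 1; abel
      rw [h2]
      have h3 : 0 < Real.exp ((L + 1) * t) * η := by positivity
      rw [heq] at h1
      nlinarith
  refine ⟨δ₀ / C, by positivity, C, hC1, fun τ hτ hδ s hs hsT => ?_⟩
  rcases (norm_nonneg (τ 0 - σ 0)).eq_or_lt with h | h
  · rw [← h, mul_zero]
    refine le_of_forall_pos_le_add fun η hη => ?_
    have h1 := main τ hτ (min (η / C) (δ₀ / C)) (by positivity) (min_le_right _ _)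
      (by rw [← h]; positivity) s hs hsT
    rw [zero_add]
    refine h1.trans ((mul_le_mul_of_nonneg_left (min_le_left _ _) hC0.le).trans_eq ?_)
    field_simp
  · exact main τ hτ _ h hδ le_rfl s hs hsT

/-- A family of backward trajectories of `X`, with reversed time, together with exponential
stability estimates. -/
structure IsSourceFlow (U : Set E) (X : E → E) (ε : ℝ) (σ : E → ℝ → E) : Prop where
  pos : 0 < ε
  apply_zero : ∀ q ∈ U, σ q 0 = q
  isReversedCurve : ∀ q ∈ U, IsReversedCurve X (σ q)
  continuous : ∀ q ∈ U, Continuous (σ q)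
  mem : ∀ q ∈ U, ∀ s, σ q s ∈ U
  add : ∀ q ∈ U, ∀ t s, 0 ≤ t → 0 ≤ s → σ (σ q t) s = σ q (t + s)
  compact : ∀ q ∈ U, ∃ Z : Set E, IsCompact Z ∧ Z ⊆ U ∧ ∀ s, σ q s ∈ Z
  neg : ∀ q ∈ U, ∀ s ≤ 0, σ q s = q
  origin : ∀ s, 0 ≤ s → σ 0 s = 0
  decay : ∀ q ∈ U, ∃ C : ℝ, 0 ≤ C ∧ ∀ s, 0 ≤ s → ‖σ q s‖ ≤ C * Real.exp (-(ε * s))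
  stable : ∀ q ∈ U, ∃ δ > 0, ∃ C : ℝ, 0 ≤ C ∧ ∀ q' ∈ U, ‖q' - q‖ ≤ δ → ∀ s, 0 ≤ s →
    ‖σ q' s - σ q s‖ ≤ C * ‖q' - q‖ * Real.exp (-(ε * s))

end ReversedCurves

/-! ### Exponential stability of the backward flow -/

section SourceFlow

variable {n : ℕ}

local notation "E" => EuclideanSpace ℝ (Fin n)

/-- Near a strictly positive source the reversed flow is exponentially contracting. -/
theorem exists_contracting_nhds {U : Set E} (hU : IsOpen U) (h0 : (0 : E) ∈ U) {X : E → E}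
    (hX : ContDiffOn ℝ ∞ X U) (hX0 : X 0 = 0)
    (hB : ∀ μ ∈ complexEigenvalues (fderiv ℝ X 0 : E →ₗ[ℝ] E), 0 < μ.re) :
    ∃ K ∈ 𝓝 (0 : E), ∃ ε > 0, ∃ D : ℝ, 0 ≤ D ∧ ∀ σ τ : ℝ → E, IsReversedCurve X σ →
      IsReversedCurve X τ → ∀ T, 0 ≤ T → σ T ∈ K → τ T ∈ K → ∀ s, T ≤ s →
      ‖σ s - τ s‖ ≤ D * Real.exp (-(ε * (s - T))) * ‖σ T - τ T‖ := by
  obtain ⟨b, m, ε, hm, hε, hb, hbm, hbB⟩ := exists_lyapunov_form _ hB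
  -- The nonlinear error may consume half of the growth rate: ‖b‖ c ≤ (ε/2) m.
  set c : ℝ := ε * m / (2 * (‖b‖ + 1)) with hc
  have hc0 : 0 < c := by positivity
  have hs : HasStrictFDerivAt X (fderiv ℝ X 0) 0 :=
    (hX.contDiffAt (hU.mem_nhds h0)).hasStrictFDerivAt (by simp)
  obtain ⟨S, hS, happ⟩ := hs.approximates_deriv_on_nhds (c := ⟨c, hc0.le⟩) (Or.inr hc0)
  obtain ⟨R, hR, hRS⟩ := Metric.mem_nhds_iff.mp hS
  -- Then b(x, x) ≤ κ forces ‖x‖ ≤ R/2, inside the region where X is close to its linearization.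
  set κ : ℝ := m * R ^ 2 / 4 with hκ
  have hκ0 : 0 < κ := by positivity
  have hmem : ∀ x, b x x ≤ κ → x ∈ S := fun x hx => hRS (by
    have h1 : m * ‖x‖ ^ 2 ≤ m * (R ^ 2 / 4) := (hbm x).trans (hx.trans_eq (by rw [hκ]; ring))
    have h2 := le_of_mul_le_mul_left h1 hm
    rw [mem_ball_zero_iff]
    nlinarith [norm_nonneg x])
  have hcon : ∀ x y, b x x ≤ κ → b y y ≤ κ →
      ε / 2 * b (x - y) (x - y) ≤ b (x - y) (X x - X y) := by
    intro x y hx hy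
    have h1 : ‖X x - X y - fderiv ℝ X 0 (x - y)‖ ≤ c * ‖x - y‖ :=
      happ x (hmem x hx) y (hmem y hy)
    have h2 : |b (x - y) (X x - X y - fderiv ℝ X 0 (x - y))| ≤
        ‖b‖ * ‖x - y‖ * (c * ‖x - y‖) :=
      (b.le_opNorm₂ _ _).trans (mul_le_mul_of_nonneg_left h1 (by positivity))
    have h3 := hbB (x - y)
    have h4 : ‖b‖ * ‖x - y‖ * (c * ‖x - y‖) ≤ ε / 2 * b (x - y) (x - y) := by
      have h5 : ‖b‖ * c ≤ ε / 2 * m := by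
        rw [hc, mul_div_assoc', div_le_iff₀ (by positivity)]
        nlinarith [mul_pos hε hm]
      calc _ = ‖b‖ * c * ‖x - y‖ ^ 2 := by ring
        _ ≤ ε / 2 * m * ‖x - y‖ ^ 2 := by gcongr
        _ = ε / 2 * (m * ‖x - y‖ ^ 2) := by ring
        _ ≤ _ := by gcongr; exact hbm _
    have h6 := (abs_le.mp h2).1
    rw [map_sub] at h6
    linarith
  refine ⟨{x | b x x ≤ κ}, ?_, ε / 2, by positivity, Real.sqrt (‖b‖ / m), Real.sqrt_nonneg _, ?_⟩
  · have hcont : Continuous fun x => b x x := b.continuous.clm_apply continuous_id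
    have : ∀ᶠ x in 𝓝 (0 : E), b x x < κ :=
      hcont.continuousAt.eventually (gt_mem_nhds (by simpa using hκ0))
    exact this.mono fun x hx => le_of_lt hx
  · intro σ τ hσ hτ T hT hσT hτT s hs
    have h1 := form_le_of_isReversedCurve hb hX0 hκ0 (half_pos hε) hcon hσ hτ hT hσT hτT hs
    have h2 : b (σ T - τ T) (σ T - τ T) ≤ ‖b‖ * ‖σ T - τ T‖ ^ 2 := by
      refine (le_abs_self _).trans ((b.le_opNorm₂ _ _).trans_eq ?_)
      ring
    have h3 : ‖σ s - τ s‖ ^ 2 ≤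
        (Real.sqrt (‖b‖ / m) * Real.exp (-(ε / 2 * (s - T))) * ‖σ T - τ T‖) ^ 2 := by
      rw [mul_pow, mul_pow, Real.sq_sqrt (by positivity), ← Real.exp_nat_mul]
      have h4 : m * ‖σ s - τ s‖ ^ 2 ≤
          Real.exp (-(2 * (ε / 2) * (s - T))) * (‖b‖ * ‖σ T - τ T‖ ^ 2) :=
        (hbm _).trans (h1.trans (mul_le_mul_of_nonneg_left h2 (Real.exp_pos _).le))
      rw [mul_comm m, ← le_div_iff₀ hm] at h4
      refine h4.trans_eq ?_
      rw [show ((2 : ℕ) : ℝ) * -(ε / 2 * (s - T)) = -(2 * (ε / 2) * (s - T)) by push_cast; ring]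
      ring
    exact abs_le_of_sq_le_sq' h3 (by positivity) |>.2

/-- Each trajectory reaches the contracting neighbourhood K at some finite time T. Continuous
dependence covers [0, T], contraction covers the rest, and a factor e^(εT) pays for the delay. The
semigroup law and the constancy of the curve at 0 follow from the stability estimate with initial
distance zero. -/
theorem exists_isSourceFlow {U : Set E} (hU : IsOpen U) (h0 : (0 : E) ∈ U) {X : E → E}
    (hX : ContDiffOn ℝ ∞ X U) (hX0 : X 0 = 0)
    (hB : ∀ μ ∈ complexEigenvalues (fderiv ℝ X 0 : E →ₗ[ℝ] E), 0 < μ.re)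
    (hstar : ∀ q ∈ U, ∃ γ : ℝ → E, γ 0 = q ∧ IsIntegralCurveOn γ (fun _ => X) (Set.Iic 0) ∧
      (∀ t ≤ 0, γ t ∈ U) ∧ Filter.Tendsto γ Filter.atBot (𝓝 0)) :
    ∃ ε σ, IsSourceFlow U X ε σ := by
  obtain ⟨K, hK, ε, hε, D, hD, hcon⟩ := exists_contracting_nhds hU h0 hX hX0 hB
  have hexp : ∀ T s : ℝ, Real.exp (-(ε * (s - T))) = Real.exp (ε * T) * Real.exp (-(ε * s)) := by
    intro T s
    rw [← Real.exp_add]; congr 1; ring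
  -- stability of a single curve
  have hstab : ∀ σ : ℝ → E, IsReversedCurve X σ → (∀ s, 0 ≤ s → σ s ∈ U) →
      Filter.Tendsto σ Filter.atTop (𝓝 0) → ∃ δ > 0, ∃ C : ℝ, 0 ≤ C ∧ ∀ τ : ℝ → E,
      IsReversedCurve X τ → ‖τ 0 - σ 0‖ ≤ δ → ∀ s, 0 ≤ s →
      ‖τ s - σ s‖ ≤ C * ‖τ 0 - σ 0‖ * Real.exp (-(ε * s)) := by
    intro σ hσ hσU hσ0
    obtain ⟨T, hT0, hT⟩ : ∃ T, 0 ≤ T ∧ σ T ∈ interior K :=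
      ((Filter.eventually_ge_atTop 0).and
        (hσ0.eventually (isOpen_interior.mem_nhds (mem_interior_iff_mem_nhds.mpr hK)))).exists
    obtain ⟨δ₁, hδ₁, hδK⟩ := Metric.isOpen_iff.mp isOpen_interior _ hT
    obtain ⟨δ₂, hδ₂, C, hC, hfin⟩ := hσ.exists_norm_sub_le hU hX hσU T hT0
    have hC0 : 0 < C := by linarith
    -- The bound δ₁/(2C) puts τ T within δ₁/2 of σ T, hence in K.
    refine ⟨min δ₂ (δ₁ / (2 * C)), by positivity, (C + D * C) * Real.exp (ε * T), by positivity,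
      fun τ hτ hδ s hs => ?_⟩
    have hf := hfin τ hτ (hδ.trans (min_le_left _ _))
    rcases le_total s T with hsT | hsT
    · have h1 : (1 : ℝ) ≤ Real.exp (ε * T) * Real.exp (-(ε * s)) := by
        rw [← hexp, Real.one_le_exp_iff]
        nlinarith
      calc ‖τ s - σ s‖ ≤ C * ‖τ 0 - σ 0‖ := hf s hs hsT
        _ ≤ C * ‖τ 0 - σ 0‖ * (Real.exp (ε * T) * Real.exp (-(ε * s))) :=
          le_mul_of_one_le_right (by positivity) h1
        _ ≤ (C + D * C) * ‖τ 0 - σ 0‖ * (Real.exp (ε * T) * Real.exp (-(ε * s))) := by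
          gcongr
          exact le_add_of_nonneg_right (by positivity)
        _ = _ := by ring
    · have hfT := hf T hT0 le_rfl
      have hτK : τ T ∈ K := by
        refine interior_subset (hδK ?_)
        rw [Metric.mem_ball, dist_eq_norm]
        calc ‖τ T - σ T‖ ≤ C * (δ₁ / (2 * C)) :=
              hfT.trans (mul_le_mul_of_nonneg_left (hδ.trans (min_le_right _ _)) hC0.le)
          _ = δ₁ / 2 := by field_simp
          _ < δ₁ := half_lt_self hδ₁
      calc ‖τ s - σ s‖ ≤ D * Real.exp (-(ε * (s - T))) * ‖τ T - σ T‖ :=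
            hcon τ σ hτ hσ T hT0 hτK (interior_subset hT) s hsT
        _ ≤ D * Real.exp (-(ε * (s - T))) * (C * ‖τ 0 - σ 0‖) := by gcongr
        _ = D * C * ‖τ 0 - σ 0‖ * (Real.exp (ε * T) * Real.exp (-(ε * s))) := by
          rw [hexp]; ring
        _ ≤ (C + D * C) * ‖τ 0 - σ 0‖ * (Real.exp (ε * T) * Real.exp (-(ε * s))) := by
          gcongr
          exact le_add_of_nonneg_left hC0.le
        _ = _ := by ring
  have hdec : ∀ σ : ℝ → E, IsReversedCurve X σ → Filter.Tendsto σ Filter.atTop (𝓝 0) →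
      ∃ C : ℝ, 0 ≤ C ∧ ∀ s, 0 ≤ s → ‖σ s‖ ≤ C * Real.exp (-(ε * s)) := by
    intro σ hσ hσ0
    obtain ⟨T, hT0, hT⟩ : ∃ T, 0 ≤ T ∧ σ T ∈ K :=
      ((Filter.eventually_ge_atTop 0).and (hσ0.eventually hK)).exists
    obtain ⟨C, hC⟩ := (isCompact_Icc (a := (0 : ℝ)) (b := T)).exists_bound_of_continuousOn
      (hσ.continuousOn.mono fun t ht => ht.1)
    have hC0 : 0 ≤ C := (norm_nonneg _).trans (hC 0 ⟨le_rfl, hT0⟩)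
    refine ⟨(C + D * C) * Real.exp (ε * T), by positivity, fun s hs => ?_⟩
    rcases le_total s T with hsT | hsT
    · have h1 : (1 : ℝ) ≤ Real.exp (ε * T) * Real.exp (-(ε * s)) := by
        rw [← hexp, Real.one_le_exp_iff]
        nlinarith
      calc ‖σ s‖ ≤ C := hC s ⟨hs, hsT⟩
        _ ≤ C * (Real.exp (ε * T) * Real.exp (-(ε * s))) :=
          le_mul_of_one_le_right hC0 h1
        _ ≤ (C + D * C) * (Real.exp (ε * T) * Real.exp (-(ε * s))) := by
          gcongr
          exact le_add_of_nonneg_right (by positivity)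
        _ = _ := by ring
    · have h := hcon σ (fun _ => 0) hσ (isReversedCurve_zero hX0) T hT0 hT (mem_of_mem_nhds hK)
        s hsT
      rw [sub_zero, sub_zero] at h
      calc ‖σ s‖ ≤ D * Real.exp (-(ε * (s - T))) * ‖σ T‖ := h
        _ ≤ D * Real.exp (-(ε * (s - T))) * C := by
          gcongr
          exact hC T ⟨hT0, le_rfl⟩
        _ = D * C * (Real.exp (ε * T) * Real.exp (-(ε * s))) := by rw [hexp]; ring
        _ ≤ (C + D * C) * (Real.exp (ε * T) * Real.exp (-(ε * s))) := by
          gcongr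
          exact le_add_of_nonneg_left hC0
        _ = _ := by ring
  choose! γ hγ0 hγ hγU hγt using hstar
  -- Freezing the curve at q for s ≤ 0 makes it continuous on all of ℝ, so that the equation along
  -- it can be solved on the whole line.
  let σ : E → ℝ → E := fun q s => γ q (-(max s 0))
  have hσpos : ∀ q s, 0 ≤ s → σ q s = γ q (-s) := fun q s hs => by simp [σ, max_eq_left hs]
  have hσc : ∀ q ∈ U, IsReversedCurve X (σ q) := by
    intro q hq s hs
    have h1 : HasDerivWithinAt (fun s => γ q (-s)) (-X (γ q (-s))) (Set.Ici 0) s := by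
      have := (hγ q hq (-s) (by simpa using hs)).scomp (g₁ := γ q) s
        (hasDerivWithinAt_id s (Set.Ici 0)).neg (fun t (ht : (0 : ℝ) ≤ t) => by simpa using ht)
      rw [neg_smul, one_smul] at this
      exact this
    rw [hσpos q s hs]
    exact h1.congr (fun t ht => hσpos q t ht) (hσpos q s hs)
  have hσU : ∀ q ∈ U, ∀ s, σ q s ∈ U := fun q hq s => hγU q hq _ (by simp)
  have hσ00 : ∀ q ∈ U, σ q 0 = q := fun q hq => by simp [σ, hγ0 q hq]
  have hσt : ∀ q ∈ U, Filter.Tendsto (σ q) Filter.atTop (𝓝 0) := by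
    intro q hq
    refine ((hγt q hq).comp Filter.tendsto_neg_atTop_atBot).congr' ?_
    filter_upwards [Filter.eventually_ge_atTop 0] with s hs
    exact (hσpos q s hs).symm
  have hσcont : ∀ q ∈ U, Continuous (σ q) := by
    intro q hq
    have : σ q = fun s => σ q (max s 0) := by funext s; simp [σ]
    rw [this]
    exact (hσc q hq).continuousOn.comp_continuous (by fun_prop) fun s => Set.mem_Ici.mpr (le_max_right _ _)
  refine ⟨ε, σ, hε, hσ00, hσc, hσcont, hσU, ?_, ?_, ?_, ?_, fun q hq => hdec _ (hσc q hq) (hσt q hq),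
    ?_⟩
  · intro q hq t s ht hs
    obtain ⟨δ, hδ, C, hC, h⟩ := hstab (σ (σ q t)) (hσc _ (hσU q hq t))
      (fun s _ => hσU _ (hσU q hq t) s) (hσt _ (hσU q hq t))
    have hτ : IsReversedCurve X fun s => σ q (t + s) := by
      intro s hs
      have := (hσc q hq (t + s) (by linarith)).scomp (g₁ := σ q) s
        ((hasDerivWithinAt_id s (Set.Ici 0)).const_add t)
        (fun r (hr : (0 : ℝ) ≤ r) => by
          simp only [Set.mem_Ici]; linarith)
      rw [one_smul] at this
      exact this
    have h1 : σ q (t + 0) = σ (σ q t) 0 := by rw [add_zero, hσ00 _ (hσU q hq t)]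
    have h2 := h (fun s => σ q (t + s)) hτ (by simp only [h1, sub_self, norm_zero]; exact hδ.le)
      s hs
    simp only [h1, sub_self, norm_zero, mul_zero, zero_mul] at h2
    exact (sub_eq_zero.mp (norm_le_zero_iff.mp h2)).symm
  · intro q hq
    obtain ⟨r, hr, hrU⟩ := Metric.nhds_basis_closedBall.mem_iff.mp (hU.mem_nhds h0)
    obtain ⟨T, hT⟩ := Filter.eventually_atTop.mp
      ((hσt q hq).eventually (Metric.closedBall_mem_nhds 0 hr))
    refine ⟨σ q '' Set.Icc 0 T ∪ Metric.closedBall 0 r ∪ {q},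
      ((isCompact_Icc.image (hσcont q hq)).union (isCompact_closedBall 0 r)).union
        isCompact_singleton, ?_, fun s => ?_⟩
    · refine Set.union_subset (Set.union_subset ?_ hrU) (by simpa using hq)
      rintro _ ⟨s, _, rfl⟩
      exact hσU q hq s
    · rcases le_total s 0 with hs | hs
      · right; simp [σ, hγ0 q hq, max_eq_right hs]
      · rcases le_total s T with hsT | hsT
        · exact Or.inl (Or.inl ⟨s, ⟨hs, hsT⟩, rfl⟩)
        · exact Or.inl (Or.inr (hT s hsT))
  · intro q hq s hs
    simp [σ, hγ0 q hq, max_eq_right hs]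
  · intro s hs
    obtain ⟨δ, hδ, C, hC, h⟩ := hstab _ (hσc 0 h0) (fun s _ => hσU 0 h0 s) (hσt 0 h0)
    have h2 := h (fun _ => 0) (isReversedCurve_zero hX0)
      (by simp only [hσ00 0 h0, sub_self, norm_zero]; exact hδ.le) s hs
    simp only [hσ00 0 h0, sub_self, norm_zero, mul_zero, zero_mul] at h2
    exact (sub_eq_zero.mp (norm_le_zero_iff.mp h2)).symm
  · intro q hq
    obtain ⟨δ, hδ, C, hC, h⟩ := hstab (σ q) (hσc q hq) (fun s _ => hσU q hq s) (hσt q hq)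
    refine ⟨δ, hδ, C, hC, fun q' hq' hqq' s hs => ?_⟩
    have := h (σ q') (hσc q' hq')
    rw [hσ00 q hq, hσ00 q' hq'] at this
    exact this hqq' s hs

end SourceFlow

/-! ### Linear equations with decaying solutions -/

section WeightedODE

open MeasureTheory

/-- A positive weight `ρ` that decays to zero with logarithmic derivative `-φ`. -/
structure IsDecayWeight (ρ φ : ℝ → ℝ) : Prop where
  hasDerivAt : ∀ s, HasDerivAt ρ (-(φ s * ρ s)) s
  pos : ∀ s, 0 < ρ s
  nonneg : ∀ s, 0 ≤ φ s
  tendsto : Filter.Tendsto ρ Filter.atTop (𝓝 0)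

/-- The factor e^(κ e^(-εs)) is bounded above and below for s ≥ 0, but raises the logarithmic decay
rate from β to β + κε e^(-εs). This surplus absorbs the excess of 2‖A‖ along a trajectory over its
limit 2‖A 0‖ ≤ β, so the contraction below works from time 0 on. -/
theorem isDecayWeight_exp {β κ ε : ℝ} (hβ : 0 < β) (hκ : 0 ≤ κ) (hε : 0 < ε) :
    IsDecayWeight (fun s => Real.exp (-(β * s) + κ * Real.exp (-(ε * s))))
      (fun s => β + κ * ε * Real.exp (-(ε * s))) where
  hasDerivAt s := by
    have h1 : ∀ c : ℝ, HasDerivAt (fun s => -(c * s)) (-c) s := fun c => by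
      have := ((hasDerivAt_id s).const_mul c).fun_neg
      rwa [mul_one] at this
    refine (((h1 β).fun_add ((h1 ε).exp.const_mul κ)).exp).congr_deriv ?_
    ring
  pos s := Real.exp_pos _
  nonneg s := by positivity
  tendsto := by
    refine Real.tendsto_exp_atBot.comp ?_
    have h1 : ∀ c : ℝ, 0 < c → Filter.Tendsto (fun s => -(c * s)) Filter.atTop Filter.atBot :=
      fun c hc => Filter.tendsto_neg_atTop_atBot.comp (Filter.tendsto_id.const_mul_atTop hc)
    exact (h1 β hβ).atBot_add ((Real.tendsto_exp_atBot.comp (h1 ε hε)).const_mul κ)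

variable {V : Type*} [NormedAddCommGroup V] [NormedSpace ℝ V]

namespace IsDecayWeight

variable {ρ φ : ℝ → ℝ}

theorem continuous (h : IsDecayWeight ρ φ) : Continuous ρ :=
  continuous_iff_continuousAt.mpr fun s => (h.hasDerivAt s).continuousAt

theorem integrableOn (h : IsDecayWeight ρ φ) (s : ℝ) :
    IntegrableOn (fun t => φ t * ρ t) (Set.Ioi s) := by
  have := integrableOn_Ioi_deriv_of_nonpos' (a := s) (fun t _ => h.hasDerivAt t)
    (fun t _ => by have := mul_nonneg (h.nonneg t) (h.pos t).le; linarith) h.tendsto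
  simpa using this.neg

theorem integral_Ioi (h : IsDecayWeight ρ φ) (s : ℝ) :
    ∫ t in Set.Ioi s, φ t * ρ t = ρ s := by
  have := integral_Ioi_of_hasDerivAt_of_nonpos' (a := s) (fun t _ => h.hasDerivAt t)
    (fun t _ => by have := mul_nonneg (h.nonneg t) (h.pos t).le; linarith) h.tendsto
  rw [integral_neg] at this
  linarith

theorem integrableOn_of_norm_le {W : Type*} [NormedAddCommGroup W] (h : IsDecayWeight ρ φ)
    {f : ℝ → W} (hf : Continuous f) {C : ℝ}
    (hC : ∀ t, ‖f t‖ ≤ C * (φ t * ρ t)) (s : ℝ) : IntegrableOn f (Set.Ioi s) :=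
  ((h.integrableOn s).const_mul C).mono' hf.aestronglyMeasurable (Filter.Eventually.of_forall hC)

theorem norm_integral_le (h : IsDecayWeight ρ φ) {f : ℝ → V} {C : ℝ}
    (hC : ∀ t, ‖f t‖ ≤ C * (φ t * ρ t)) (s : ℝ) : ‖∫ t in Set.Ioi s, f t‖ ≤ C * ρ s := by
  refine (norm_integral_le_of_norm_le ((h.integrableOn s).const_mul C)
    (Filter.Eventually.of_forall hC)).trans_eq ?_
  rw [integral_const_mul, h.integral_Ioi]

theorem hasDerivAt_integral [CompleteSpace V] (h : IsDecayWeight ρ φ) {f : ℝ → V}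
    (hf : Continuous f) {C : ℝ} (hC : ∀ t, ‖f t‖ ≤ C * (φ t * ρ t)) (s : ℝ) :
    HasDerivAt (fun s => ∫ t in Set.Ioi s, f t) (-f s) s := by
  have h1 : (fun s => ∫ t in Set.Ioi s, f t) =
      fun x => (∫ t in Set.Ioi s, f t) - ∫ t in s..x, f t := by
    funext x
    rw [← intervalIntegral.integral_interval_add_Ioi (h.integrableOn_of_norm_le hf hC s)
      (h.integrableOn_of_norm_le hf hC x)]
    abel
  rw [h1]
  exact (hf.integral_hasStrictDerivAt s s).hasDerivAt.const_sub _

/-- A linear differential equation whose coefficient is dominated by the weight has a solution that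
decays like the weight. -/
theorem exists_solution [CompleteSpace V] (h : IsDecayWeight ρ φ) {a : ℝ → V →L[ℝ] V} {w : ℝ → V}
    (ha : Continuous a) (hw : Continuous w) (haφ : ∀ s, 2 * ‖a s‖ ≤ φ s) {C : ℝ}
    (hwφ : ∀ s, ‖w s‖ ≤ C * (φ s * ρ s)) :
    ∃ (z : ℝ → V) (N : ℝ), (∀ s, HasDerivAt z (a s (z s) - w s) s) ∧ ∀ s, ‖z s‖ ≤ N * ρ s := by
  have hρ := h.continuous
  have hay : ∀ (y : BoundedContinuousFunction ℝ V) t,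
      ‖a t (ρ t • y t)‖ ≤ ‖y‖ / 2 * (φ t * ρ t) := fun y t => by
    have hp := (h.pos t).le
    calc ‖a t (ρ t • y t)‖ ≤ ‖a t‖ * ‖ρ t • y t‖ := (a t).le_opNorm _
      _ = ‖a t‖ * (ρ t * ‖y t‖) := by rw [norm_smul, Real.norm_of_nonneg hp]
      _ ≤ φ t / 2 * (ρ t * ‖y‖) := by
        have h1 : ‖a t‖ ≤ φ t / 2 := by linarith [haφ t]
        have h2 : 0 ≤ φ t := h.nonneg t
        gcongr
        exact y.norm_coe_le_norm t
      _ = _ := by ring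
  have hayc : ∀ y : BoundedContinuousFunction ℝ V, Continuous fun t => a t (ρ t • y t) :=
    fun y => ha.clm_apply (hρ.smul y.continuous)
  have hfb : ∀ (y : BoundedContinuousFunction ℝ V) t,
      ‖w t - a t (ρ t • y t)‖ ≤ (C + ‖y‖ / 2) * (φ t * ρ t) := fun y t => by
    rw [add_mul]
    exact (norm_sub_le _ _).trans (add_le_add (hwφ t) (hay y t))
  have hfc : ∀ y : BoundedContinuousFunction ℝ V, Continuous fun t => w t - a t (ρ t • y t) :=
    fun y => hw.sub (hayc y)
  have hdiv : ∀ {x : V} {c : ℝ} {s : ℝ}, ‖x‖ ≤ c * ρ s → ‖(ρ s)⁻¹ • x‖ ≤ c := by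
    intro x c s hx
    rw [norm_smul, norm_inv, Real.norm_of_nonneg (h.pos s).le, inv_mul_le_iff₀ (h.pos s), mul_comm]
    exact hx
  -- Write z = ρy with y bounded and integrate from infinity: z(s) = ∫_s^∞ (w - a z). Since 2‖a‖ ≤ φ
  -- and ∫_s^∞ φρ = ρ(s), this is a contraction with constant 1/2.
  let F : BoundedContinuousFunction ℝ V → BoundedContinuousFunction ℝ V := fun y =>
    BoundedContinuousFunction.ofNormedAddCommGroup
      (fun s => (ρ s)⁻¹ • ∫ t in Set.Ioi s, (w t - a t (ρ t • y t)))
      ((hρ.inv₀ fun s => (h.pos s).ne').smul (continuous_iff_continuousAt.mpr fun s =>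
        (h.hasDerivAt_integral (hfc y) (hfb y) s).continuousAt))
      (C + ‖y‖ / 2) (fun s => hdiv (h.norm_integral_le (hfb y) s))
  have hF : ∀ y s, F y s = (ρ s)⁻¹ • ∫ t in Set.Ioi s, (w t - a t (ρ t • y t)) := fun _ _ => rfl
  have hcontr : ContractingWith (1 / 2) F := by
    refine ⟨by rw [← NNReal.coe_lt_coe]; norm_num, LipschitzWith.of_dist_le_mul fun y y' => ?_⟩
    rw [BoundedContinuousFunction.dist_le (by positivity)]
    intro s
    rw [dist_eq_norm, hF, hF, ← smul_sub, ← integral_sub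
      (h.integrableOn_of_norm_le (hfc y) (hfb y) s) (h.integrableOn_of_norm_le (hfc y') (hfb y') s)]
    refine hdiv (h.norm_integral_le (fun t => ?_) s)
    have h1 : w t - a t (ρ t • y t) - (w t - a t (ρ t • y' t)) = a t (ρ t • (y' - y) t) := by
      simp only [BoundedContinuousFunction.coe_sub, Pi.sub_apply, smul_sub, map_sub]
      abel
    rw [h1]
    refine (hay _ t).trans_eq ?_
    rw [dist_comm, dist_eq_norm]
    push_cast
    ring
  obtain ⟨y, hy⟩ : ∃ y, F y = y := ⟨_, hcontr.fixedPoint_isFixedPt⟩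
  refine ⟨fun s => ρ s • y s, ‖y‖, fun s => ?_, fun s => ?_⟩
  · have h1 : (fun s => ρ s • y s) = fun s => ∫ t in Set.Ioi s, (w t - a t (ρ t • y t)) := by
      funext s
      conv_lhs => rw [← hy]
      rw [hF, smul_inv_smul₀ (h.pos s).ne']
    have h2 := h.hasDerivAt_integral (hfc y) (hfb y) s
    rw [← h1, neg_sub] at h2
    exact h2
  · rw [norm_smul, Real.norm_of_nonneg (h.pos s).le, mul_comm]
    exact mul_le_mul_of_nonneg_right (y.norm_coe_le_norm s) (h.pos s).le

/-- An a priori estimate for solutions that decay like the weight. -/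
theorem norm_le_of_hasDerivWithinAt (h : IsDecayWeight ρ φ) {a : ℝ → V →L[ℝ] V} {f z : ℝ → V}
    (haφ : ∀ s, 0 ≤ s → 2 * ‖a s‖ ≤ φ s) {F : ℝ} (hF : 0 ≤ F)
    (hfφ : ∀ s, 0 ≤ s → ‖f s‖ ≤ F * (φ s * ρ s))
    (hz : ∀ s, 0 ≤ s → HasDerivWithinAt z (a s (z s) - f s) (Set.Ici 0) s) {N : ℝ}
    (hN : ∀ s, 0 ≤ s → ‖z s‖ ≤ N * ρ s) {s : ℝ} (hs : 0 ≤ s) : ‖z s‖ ≤ 2 * F * ρ s := by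
  have hN0 : 0 ≤ N := by
    have h1 := (norm_nonneg _).trans (hN 0 le_rfl)
    exact nonneg_of_mul_nonneg_left h1 (h.pos 0)
  -- Integrating from infinity improves any bound N to N/2 + F; iteration drives it to the fixed
  -- point 2F, independent of the initial N.
  have step : ∀ N : ℝ, 0 ≤ N → (∀ s, 0 ≤ s → ‖z s‖ ≤ N * ρ s) →
      ∀ s, 0 ≤ s → ‖z s‖ ≤ (N / 2 + F) * ρ s := by
    intro N hN0 hN s hs
    have hdiff : ∀ S, s ≤ S → ‖z s‖ ≤ N * ρ S + (N / 2 + F) * ρ s := by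
      intro S hS
      have key := image_norm_le_of_norm_deriv_right_le_deriv_boundary (f := fun t => z t - z s)
        (a := s) (b := S) (f' := fun t => a t (z t) - f t)
        (B := fun t => (N / 2 + F) * (ρ s - ρ t)) (B' := fun t => (N / 2 + F) * (φ t * ρ t))
        (fun t ht => (((hz t (hs.trans ht.1)).continuousWithinAt).mono
          fun r hr => hs.trans hr.1).sub continuousWithinAt_const)
        (fun t ht => ((hz t (hs.trans ht.1)).mono
          (Set.Ici_subset_Ici.mpr (hs.trans ht.1))).sub_const _) (by simp)
        (fun t => (((h.hasDerivAt t).const_sub (ρ s)).const_mul (N / 2 + F)).congr_deriv (by ring))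
        (fun t ht => ?_) (x := S) ⟨hS, le_rfl⟩
      · have h1 : ‖z s‖ ≤ ‖z S‖ + ‖z S - z s‖ := by
          rw [norm_sub_rev]
          have := norm_add_le (z S) (z s - z S)
          rwa [add_sub_cancel] at this
        have h2 := hN S (hs.trans hS)
        have h3 : 0 ≤ (N / 2 + F) * ρ S := mul_nonneg (by positivity) (h.pos S).le
        have h4 : (N / 2 + F) * (ρ s - ρ S) = (N / 2 + F) * ρ s - (N / 2 + F) * ρ S := by ring
        linarith
      · have ht0 := hs.trans ht.1
        have hp := (h.pos t).le
        have hn := h.nonneg t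
        have h1 : ‖a t‖ ≤ φ t / 2 := by linarith [haφ t ht0]
        calc ‖a t (z t) - f t‖ ≤ ‖a t‖ * ‖z t‖ + ‖f t‖ :=
              (norm_sub_le _ _).trans (add_le_add_left ((a t).le_opNorm _) _)
          _ ≤ φ t / 2 * (N * ρ t) + F * (φ t * ρ t) := by
            gcongr
            exacts [hN t ht0, hfφ t ht0]
          _ = _ := by ring
    have hlim : Filter.Tendsto (fun S => N * ρ S + (N / 2 + F) * ρ s) Filter.atTop
        (𝓝 (N * 0 + (N / 2 + F) * ρ s)) := (h.tendsto.const_mul N).add_const _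
    rw [mul_zero, zero_add] at hlim
    exact ge_of_tendsto hlim ((Filter.eventually_ge_atTop s).mono hdiff)
  have iter : ∀ k : ℕ, ∀ s, 0 ≤ s → ‖z s‖ ≤ (2 * F + N * (1 / 2) ^ k) * ρ s := by
    intro k
    induction k with
    | zero =>
      intro s hs
      refine (hN s hs).trans (mul_le_mul_of_nonneg_right ?_ (h.pos s).le)
      linarith
    | succ k ih =>
      intro s hs
      refine (step _ (by positivity) ih s hs).trans_eq ?_
      ring
  have hlim : Filter.Tendsto (fun k : ℕ => (2 * F + N * (1 / 2 : ℝ) ^ k) * ρ s) Filter.atTop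
      (𝓝 ((2 * F + N * 0) * ρ s)) :=
    (((tendsto_pow_atTop_nhds_zero_of_lt_one (by norm_num) (by norm_num)).const_mul N).const_add
      _).mul_const _
  rw [mul_zero, add_zero] at hlim
  exact ge_of_tendsto' hlim fun k => iter k s hs

end IsDecayWeight

end WeightedODE

/-! ### Solutions along trajectories -/

section FlowSolution

universe u

variable {E : Type} [NormedAddCommGroup E] [NormedSpace ℝ E]

variable {V : Type u} [NormedAddCommGroup V] [NormedSpace ℝ V]

/-- `u` solves `(D_X + A) u = w` along all curves `s ↦ σ q s`, and decays at least at rate `β` along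
them. -/
def IsFlowSolution (U : Set E) (σ : E → ℝ → E) (A : E → V →L[ℝ] V) (w : E → V) (β : ℝ)
    (u : E → V) : Prop :=
  ∀ q ∈ U, (∀ s, 0 ≤ s → HasDerivWithinAt (fun s => u (σ q s))
    (A (σ q s) (u (σ q s)) - w (σ q s)) (Set.Ici 0) s) ∧
    ∃ C : ℝ, ∀ s, 0 ≤ s → ‖u (σ q s)‖ ≤ C * Real.exp (-(β * s))

variable {U : Set E} {X : E → E} {ε : ℝ} {σ : E → ℝ → E} {A : E → V →L[ℝ] V}

theorem exp_neg_mul_le_of_le {a b s : ℝ} (h : a ≤ b) (hs : 0 ≤ s) :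
    Real.exp (-(b * s)) ≤ Real.exp (-(a * s)) :=
  Real.exp_le_exp.mpr (neg_le_neg (mul_le_mul_of_nonneg_right h hs))

theorem exp_neg_mul_pow (ε s : ℝ) (M : ℕ) :
    Real.exp (-(ε * s)) ^ M = Real.exp (-(M * ε * s)) := by
  rw [← Real.exp_nat_mul]; congr 1; ring

theorem IsSourceFlow.exists_norm_comp_le (hσ : IsSourceFlow U X ε σ) (hU : IsOpen U)
    (h0 : (0 : E) ∈ U) {w : E → V} (hw : ContDiffOn ℝ ∞ w U) {M : ℕ} (hwM : VanishesToOrder M w)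
    {β : ℝ} (hβ : β ≤ M * ε) {q : E} (hq : q ∈ U) :
    ∃ C : ℝ, 0 ≤ C ∧ ∀ s, 0 ≤ s → ‖w (σ q s)‖ ≤ C * Real.exp (-(β * s)) := by
  obtain ⟨Z, hZ, hZU, hqZ⟩ := hσ.compact q hq
  obtain ⟨C, hC, hw'⟩ := hwM.exists_norm_le_of_isCompact hU h0 hw hZ hZU
  obtain ⟨C', hC', hd⟩ := hσ.decay q hq
  refine ⟨C * C' ^ M, by positivity, fun s hs => ?_⟩
  calc ‖w (σ q s)‖ ≤ C * ‖σ q s‖ ^ M := hw' _ (hqZ s)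
    _ ≤ C * (C' * Real.exp (-(ε * s))) ^ M := by gcongr; exact hd s hs
    _ = C * C' ^ M * Real.exp (-(M * ε * s)) := by rw [mul_pow, exp_neg_mul_pow]; ring
    _ ≤ _ := by gcongr

/-- A - A(0) vanishes at 0 and so decays along the trajectory of q; the Lipschitz bound and
stability carry this over to nearby trajectories with one constant α. -/
theorem IsSourceFlow.exists_coeff_le [ProperSpace E] (hσ : IsSourceFlow U X ε σ) (hU : IsOpen U)
    (h0 : (0 : E) ∈ U) (hA : ContDiffOn ℝ ∞ A U) {q : E} (hq : q ∈ U) :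
    ∃ δ > 0, ∃ α : ℝ, 0 ≤ α ∧ ∀ q' ∈ U, ‖q' - q‖ ≤ δ → ∀ s, 0 ≤ s →
      ‖A (σ q' s)‖ ≤ ‖A 0‖ + α * Real.exp (-(ε * s)) := by
  obtain ⟨Z, hZ, hZU, hqZ⟩ := hσ.compact q hq
  obtain ⟨δ₁, hδ₁, L, hL, hlip⟩ := hA.exists_lipschitz_le hU hZ hZU
  obtain ⟨δ₂, hδ₂, C₂, hC₂, hst⟩ := hσ.stable q hq
  obtain ⟨C, hC, hA0⟩ := hσ.exists_norm_comp_le hU h0 (w := fun y => A y - A 0) (M := 1) (β := ε)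
    (hA.sub contDiffOn_const)
    (vanishesToOrder_succ_iff.mpr ⟨sub_self _, vanishesToOrder_zero _⟩) (by simp) hq
  refine ⟨min δ₂ (δ₁ / (C₂ + 1)), by positivity, C + L * (C₂ * δ₂), by positivity,
    fun q' hq' hδ s hs => ?_⟩
  have h1 := hst q' hq' (hδ.trans (min_le_left _ _)) s hs
  have he : Real.exp (-(ε * s)) ≤ 1 :=
    Real.exp_le_one_iff.mpr (by have := mul_nonneg hσ.pos.le hs; linarith)
  have h2 : ‖σ q' s - σ q s‖ ≤ δ₁ := by
    calc _ ≤ C₂ * ‖q' - q‖ * Real.exp (-(ε * s)) := h1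
      _ ≤ C₂ * ‖q' - q‖ := mul_le_of_le_one_right (by positivity) he
      _ ≤ (C₂ + 1) * (δ₁ / (C₂ + 1)) := by
        gcongr
        · linarith
        · exact hδ.trans (min_le_right _ _)
      _ = δ₁ := by field_simp
  have h3 := hlip _ (hqZ s) _ h2
  have h4 : A (σ q' s) = A 0 + ((A (σ q s) - A 0) + (A (σ q' s) - A (σ q s))) := by abel
  rw [h4]
  refine (norm_add_le _ _).trans (add_le_add_right ((norm_add_le _ _).trans ?_) _)
  rw [add_mul]
  refine add_le_add (hA0 s hs) (h3.trans ?_)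
  rw [mul_assoc]
  gcongr
  refine h1.trans ?_
  gcongr
  exact hδ.trans (min_le_left _ _)

/-- Decaying solutions along a trajectory are bounded by the right-hand side, uniformly for
trajectories with nearby initial values. -/
theorem IsSourceFlow.exists_apriori [ProperSpace E] (hσ : IsSourceFlow U X ε σ) (hU : IsOpen U)
    (h0 : (0 : E) ∈ U) (hA : ContDiffOn ℝ ∞ A U) {β : ℝ} (hβ0 : 0 < β) (hβ : 2 * ‖A 0‖ ≤ β) {q : E}
    (hq : q ∈ U) :
    ∃ δ > 0, ∃ D : ℝ, 0 ≤ D ∧ ∀ q' ∈ U, ‖q' - q‖ ≤ δ → ∀ (z f : ℝ → V) (F N : ℝ), 0 ≤ F →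
      (∀ s, 0 ≤ s → ‖f s‖ ≤ F * Real.exp (-(β * s))) →
      (∀ s, 0 ≤ s → HasDerivWithinAt z (A (σ q' s) (z s) - f s) (Set.Ici 0) s) →
      (∀ s, 0 ≤ s → ‖z s‖ ≤ N * Real.exp (-(β * s))) →
      ∀ s, 0 ≤ s → ‖z s‖ ≤ D * F * Real.exp (-(β * s)) := by
  obtain ⟨δ, hδ, α, hα, hcoeff⟩ := hσ.exists_coeff_le hU h0 hA hq
  have hε := hσ.pos
  -- For this κ the logarithmic rate of the weight is β + 2α e^(-εs), which dominates 2‖A‖ along the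
  -- curve. The weight exceeds e^(-βs) by at most the factor e^κ.
  set κ := 2 * α / ε with hκ
  have hκ0 : 0 ≤ κ := by positivity
  have hW := isDecayWeight_exp hβ0 hκ0 hε
  refine ⟨δ, hδ, 2 / β * Real.exp κ, by positivity,
    fun q' hq' hqδ z f F N hF hf hz hN s hs => ?_⟩
  have hle : ∀ s : ℝ,
      Real.exp (-(β * s)) ≤ Real.exp (-(β * s) + κ * Real.exp (-(ε * s))) := fun s =>
    Real.exp_le_exp.mpr (le_add_of_nonneg_right (by positivity))
  have hN0 : 0 ≤ N := by
    have h1 := (norm_nonneg _).trans (hN 0 le_rfl)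
    exact nonneg_of_mul_nonneg_left h1 (Real.exp_pos _)
  have key := hW.norm_le_of_hasDerivWithinAt (a := fun s => A (σ q' s)) (f := f) (z := z)
    (F := F / β) (N := N) (fun s hs => ?_) (by positivity) (fun s hs => ?_) hz
    (fun s hs => (hN s hs).trans (mul_le_mul_of_nonneg_left (hle s) hN0)) hs
  · refine key.trans ?_
    have h1 : Real.exp (-(β * s) + κ * Real.exp (-(ε * s))) ≤
        Real.exp κ * Real.exp (-(β * s)) := by
      rw [← Real.exp_add, add_comm]
      refine Real.exp_le_exp.mpr (add_le_add_left (mul_le_of_le_one_right hκ0 ?_) _)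
      exact Real.exp_le_one_iff.mpr (by have := mul_nonneg hε.le hs; linarith)
    calc _ ≤ 2 * (F / β) * (Real.exp κ * Real.exp (-(β * s))) := by gcongr
      _ = _ := by ring
  · have h1 := hcoeff q' hq' hqδ s hs
    have h2 : κ * ε = 2 * α := by rw [hκ]; field_simp
    simp only [h2]
    linarith
  · refine (hf s hs).trans ?_
    have h1 : F * Real.exp (-(β * s)) =
        F / β * (β * Real.exp (-(β * s))) := by field_simp
    rw [h1]
    have h2 : 0 ≤ κ * ε * Real.exp (-(ε * s)) := by positivity
    gcongr
    · linarith
    · exact Real.exp_le_exp.mp (hle s)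

theorem IsSourceFlow.eq_of_hasDerivWithinAt [ProperSpace E] (hσ : IsSourceFlow U X ε σ) (hU : IsOpen U)
    (h0 : (0 : E) ∈ U) (hA : ContDiffOn ℝ ∞ A U) {β : ℝ} (hβ0 : 0 < β) (hβ : 2 * ‖A 0‖ ≤ β) {q : E}
    (hq : q ∈ U) {w z₁ z₂ : ℝ → V} {N₁ N₂ : ℝ}
    (h₁ : ∀ s, 0 ≤ s → HasDerivWithinAt z₁ (A (σ q s) (z₁ s) - w s) (Set.Ici 0) s)
    (h₂ : ∀ s, 0 ≤ s → HasDerivWithinAt z₂ (A (σ q s) (z₂ s) - w s) (Set.Ici 0) s)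
    (hN₁ : ∀ s, 0 ≤ s → ‖z₁ s‖ ≤ N₁ * Real.exp (-(β * s)))
    (hN₂ : ∀ s, 0 ≤ s → ‖z₂ s‖ ≤ N₂ * Real.exp (-(β * s))) {s : ℝ} (hs : 0 ≤ s) :
    z₁ s = z₂ s := by
  obtain ⟨δ, hδ, D, hD, h⟩ := hσ.exists_apriori hU h0 hA hβ0 hβ hq
  have := h q hq (by simpa using hδ.le) (fun s => z₁ s - z₂ s) (fun _ => 0) 0 (N₁ + N₂) le_rfl
    (fun s _ => by simp) (fun s hs => ?_) (fun s hs => ?_) s hs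
  · rw [mul_zero, zero_mul] at this
    exact sub_eq_zero.mp (norm_le_zero_iff.mp this)
  · refine ((h₁ s hs).sub (h₂ s hs)).congr_deriv ?_
    rw [map_sub]; abel
  · rw [add_mul]
    exact (norm_sub_le _ _).trans (add_le_add (hN₁ s hs) (hN₂ s hs))

theorem IsSourceFlow.exists_trajectory_solution [ProperSpace E] [CompleteSpace V] (hσ : IsSourceFlow U X ε σ)
    (hU : IsOpen U) (h0 : (0 : E) ∈ U) (hA : ContDiffOn ℝ ∞ A U) {β : ℝ} (hβ0 : 0 < β)
    (hβ : 2 * ‖A 0‖ ≤ β) {w : E → V} (hw : ContDiffOn ℝ ∞ w U) {M : ℕ} (hwM : VanishesToOrder M w)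
    (hβM : β ≤ M * ε) {q : E} (hq : q ∈ U) :
    ∃ (z : ℝ → V) (N : ℝ),
      (∀ s, 0 ≤ s → HasDerivWithinAt z (A (σ q s) (z s) - w (σ q s)) (Set.Ici 0) s) ∧
      ∀ s, 0 ≤ s → ‖z s‖ ≤ N * Real.exp (-(β * s)) := by
  obtain ⟨δ, hδ, α, hα, hcoeff⟩ := hσ.exists_coeff_le hU h0 hA hq
  obtain ⟨C, hC, hwC⟩ := hσ.exists_norm_comp_le hU h0 hw hwM hβM hq
  have hε := hσ.pos
  set κ := 2 * α / ε with hκ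
  have hκ0 : 0 ≤ κ := by positivity
  have hκε : κ * ε = 2 * α := by rw [hκ]; field_simp
  have hW := isDecayWeight_exp hβ0 hκ0 hε
  have hσ0 : ∀ s ≤ 0, σ q s = σ q 0 := fun s hs => by rw [hσ.neg q hq s hs, hσ.apply_zero q hq]
  have hone : ∀ c s : ℝ, 0 < c → s ≤ 0 → Real.exp (-(c * 0)) ≤ Real.exp (-(c * s)) :=
    fun c s hc hs => Real.exp_le_exp.mpr (by nlinarith)
  have ha : ∀ s, 2 * ‖A (σ q s)‖ ≤ β + κ * ε * Real.exp (-(ε * s)) := by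
    intro s
    have h1 : ‖A (σ q s)‖ ≤ ‖A 0‖ + α * Real.exp (-(ε * s)) := by
      rcases le_total 0 s with hs | hs
      · exact hcoeff q hq (by simpa using hδ.le) s hs
      · rw [hσ0 s hs]
        exact (hcoeff q hq (by simpa using hδ.le) 0 le_rfl).trans
          (add_le_add le_rfl (mul_le_mul_of_nonneg_left (hone ε s hε hs) hα))
    rw [hκε]
    linarith
  have hwb : ∀ s, ‖w (σ q s)‖ ≤ C / β * ((β + κ * ε * Real.exp (-(ε * s))) *
      Real.exp (-(β * s) + κ * Real.exp (-(ε * s)))) := by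
    intro s
    have h1 : ‖w (σ q s)‖ ≤ C * Real.exp (-(β * s)) := by
      rcases le_total 0 s with hs | hs
      · exact hwC s hs
      · rw [hσ0 s hs]
        exact (hwC 0 le_rfl).trans (mul_le_mul_of_nonneg_left (hone β s hβ0 hs) hC)
    refine h1.trans ?_
    have h2 : C * Real.exp (-(β * s)) = C / β * (β * Real.exp (-(β * s))) := by field_simp
    rw [h2]
    have h3 : 0 ≤ κ * ε * Real.exp (-(ε * s)) := by positivity
    have h4 : 0 ≤ κ * Real.exp (-(ε * s)) := by positivity
    gcongr
    · linarith
    · linarith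
  obtain ⟨z, N, hz, hzN⟩ := hW.exists_solution
    (hA.continuousOn.comp_continuous (hσ.continuous q hq) (hσ.mem q hq))
    (hw.continuousOn.comp_continuous (hσ.continuous q hq) (hσ.mem q hq)) ha hwb
  refine ⟨z, N * Real.exp κ, fun s _ => (hz s).hasDerivWithinAt, fun s hs => (hzN s).trans ?_⟩
  have hN0 : 0 ≤ N := by
    have h1 := (norm_nonneg _).trans (hzN 0)
    exact nonneg_of_mul_nonneg_left h1 (Real.exp_pos _)
  rw [mul_assoc]
  refine mul_le_mul_of_nonneg_left ?_ hN0
  rw [← Real.exp_add, add_comm]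
  refine Real.exp_le_exp.mpr (add_le_add_left (mul_le_of_le_one_right hκ0 ?_) _)
  exact Real.exp_le_one_iff.mpr (by have := mul_nonneg hε.le hs; linarith)

/-- Put u(q) = z_q(0). The time shift of z_q is a decaying solution along the trajectory of σ q t,
so uniqueness gives u(σ q t) = z_q(t), and the separately chosen solutions fit together. -/
theorem IsSourceFlow.exists_isFlowSolution [ProperSpace E] [CompleteSpace V] (hσ : IsSourceFlow U X ε σ)
    (hU : IsOpen U) (h0 : (0 : E) ∈ U) (hA : ContDiffOn ℝ ∞ A U) {β : ℝ} (hβ0 : 0 < β)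
    (hβ : 2 * ‖A 0‖ ≤ β) {w : E → V} (hw : ContDiffOn ℝ ∞ w U) {M : ℕ} (hwM : VanishesToOrder M w)
    (hβM : β ≤ M * ε) : ∃ u, IsFlowSolution U σ A w β u := by
  choose! z N hz hN using fun q (hq : q ∈ U) =>
    hσ.exists_trajectory_solution hU h0 hA hβ0 hβ hw hwM hβM hq
  refine ⟨fun q => z q 0, fun q hq => ?_⟩
  have heq : ∀ t, 0 ≤ t → z (σ q t) 0 = z q t := by
    intro t ht
    have hqt := hσ.mem q hq t
    have := hσ.eq_of_hasDerivWithinAt hU h0 hA hβ0 hβ hqt (w := fun s => w (σ (σ q t) s))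
      (z₁ := z (σ q t)) (z₂ := fun s => z q (t + s)) (N₁ := N (σ q t)) (N₂ := |N q|) (hz _ hqt)
      (fun s hs => ?_) (hN _ hqt) (fun s hs => ?_) le_rfl
    · rwa [add_zero] at this
    · rw [hσ.add q hq t s ht hs]
      have := (hz q hq (t + s) (by linarith)).scomp (g₁ := z q) s
        ((hasDerivWithinAt_id s (Set.Ici 0)).const_add t)
        (fun r (hr : (0 : ℝ) ≤ r) => by simp only [Set.mem_Ici]; linarith)
      rw [one_smul] at this
      exact this
    · refine (hN q hq (t + s) (by linarith)).trans ?_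
      have h1 : Real.exp (-(β * (t + s))) ≤ Real.exp (-(β * s)) :=
        Real.exp_le_exp.mpr (by nlinarith)
      gcongr
      exact le_abs_self _
  refine ⟨fun s hs => ?_, N q, fun s hs => by simpa only [heq s hs] using hN q hq s hs⟩
  simp only [heq s hs]
  exact (hz q hq s hs).congr (fun t ht => heq t ht) (heq s hs)

theorem IsFlowSolution.eqOn [ProperSpace E] (hσ : IsSourceFlow U X ε σ) (hU : IsOpen U)
    (h0 : (0 : E) ∈ U) (hA : ContDiffOn ℝ ∞ A U) {β : ℝ} (hβ0 : 0 < β) (hβ : 2 * ‖A 0‖ ≤ β)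
    {w u₁ u₂ : E → V} (h₁ : IsFlowSolution U σ A w β u₁) (h₂ : IsFlowSolution U σ A w β u₂) :
    Set.EqOn u₁ u₂ U := by
  intro q hq
  obtain ⟨hz₁, N₁, hN₁⟩ := h₁ q hq
  obtain ⟨hz₂, N₂, hN₂⟩ := h₂ q hq
  have := hσ.eq_of_hasDerivWithinAt hU h0 hA hβ0 hβ hq hz₁ hz₂ hN₁ hN₂ le_rfl
  simpa only [hσ.apply_zero q hq] using this

theorem IsFlowSolution.mono {S : Type} {U : Set S} {σ : S → ℝ → S} {A : S → V →L[ℝ] V} {β β' : ℝ} (hβ : β' ≤ β)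
    {w u : S → V}
    (h : IsFlowSolution U σ A w β u) : IsFlowSolution U σ A w β' u := fun q hq => by
  obtain ⟨hz, N, hN⟩ := h q hq
  refine ⟨hz, N, fun s hs => (hN s hs).trans ?_⟩
  have hN0 : 0 ≤ N := by
    have h1 := (norm_nonneg _).trans (hN 0 le_rfl)
    exact nonneg_of_mul_nonneg_left h1 (Real.exp_pos _)
  exact mul_le_mul_of_nonneg_left (exp_neg_mul_le_of_le hβ hs) hN0

theorem IsFlowSolution.sub {S : Type} {U : Set S} {σ : S → ℝ → S} {A : S → V →L[ℝ] V} {β : ℝ}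
    {w₁ w₂ u₁ u₂ : S → V} (h₁ : IsFlowSolution U σ A w₁ β u₁)
    (h₂ : IsFlowSolution U σ A w₂ β u₂) :
    IsFlowSolution U σ A (fun y => w₁ y - w₂ y) β (fun y => u₁ y - u₂ y) := fun q hq => by
  obtain ⟨hz₁, N₁, hN₁⟩ := h₁ q hq
  obtain ⟨hz₂, N₂, hN₂⟩ := h₂ q hq
  refine ⟨fun s hs => ((hz₁ s hs).sub (hz₂ s hs)).congr_deriv ?_, N₁ + N₂, fun s hs => ?_⟩
  · beta_reduce
    rw [map_sub]; abel
  · rw [add_mul]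
    exact (norm_sub_le _ _).trans (add_le_add (hN₁ s hs) (hN₂ s hs))

theorem IsFlowSolution.apply_zero (hσ : IsSourceFlow U X ε σ) (h0 : (0 : E) ∈ U) {β : ℝ}
    (hβ : 0 < β) {w u : E → V} (h : IsFlowSolution U σ A w β u) : u 0 = 0 := by
  obtain ⟨-, C, hC⟩ := h 0 h0
  have hlim : Filter.Tendsto (fun s => C * Real.exp (-(β * s))) Filter.atTop (𝓝 (C * 0)) :=
    (Real.tendsto_exp_atBot.comp (Filter.tendsto_neg_atTop_atBot.comp
      (Filter.tendsto_id.const_mul_atTop hβ))).const_mul C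
  rw [mul_zero] at hlim
  refine norm_le_zero_iff.mp (ge_of_tendsto hlim ?_)
  filter_upwards [Filter.eventually_ge_atTop 0] with s hs
  have := hC s hs
  rwa [hσ.origin s hs] at this

theorem isFlowSolution_of_contDiffOn (hσ : IsSourceFlow U X ε σ) (hU : IsOpen U)
    (h0 : (0 : E) ∈ U) {p : E → V} (hp : ContDiffOn ℝ ∞ p U) {M : ℕ} (hpM : VanishesToOrder M p)
    {β : ℝ} (hβM : β ≤ M * ε) :
    IsFlowSolution U σ A (fun y => fderiv ℝ p y (X y) + A y (p y)) β p := fun q hq => by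
  obtain ⟨C, -, hC⟩ := hσ.exists_norm_comp_le hU h0 hp hpM hβM hq
  refine ⟨fun s hs => ?_, C, hC⟩
  have h1 := (hp.differentiableAt_infty hU (hσ.mem q hq s)).hasFDerivAt.comp_hasDerivWithinAt s
    (hσ.isReversedCurve q hq s hs)
  refine h1.congr_deriv ?_
  beta_reduce
  rw [map_neg]; abel

theorem IsFlowSolution.transport_eq (hσ : IsSourceFlow U X ε σ) {β : ℝ} {w u : E → V}
    (h : IsFlowSolution U σ A w β u) {q : E} (hq : q ∈ U) (hu : DifferentiableAt ℝ u q) :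
    fderiv ℝ u q (X q) + A q (u q) = w q := by
  have h1 := (h q hq).1 0 le_rfl
  have hu' : HasFDerivAt u (fderiv ℝ u q) (σ q 0) := by
    rw [hσ.apply_zero q hq]; exact hu.hasFDerivAt
  have h2 := hu'.comp_hasDerivWithinAt 0 (hσ.isReversedCurve q hq 0 le_rfl)
  have h3 := (uniqueDiffOn_Ici (0 : ℝ) 0 Set.self_mem_Ici).eq_deriv _ h1 h2
  rw [hσ.apply_zero q hq, map_neg] at h3
  rw [← neg_eq_iff_eq_neg] at h3
  rw [← h3]; abel

end FlowSolution

/-! ### Differentiability by prolongation to (u, Du) -/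

section Prolongation

universe u

variable {E : Type} [NormedAddCommGroup E] [NormedSpace ℝ E]
  {V : Type u} [NormedAddCommGroup V] [NormedSpace ℝ V]

/-- The coefficient of the equation satisfied by `(u, Du)` if `u` solves `(D_X + A) u = w`. -/
noncomputable def prolongCoeff (X : E → E) (A : E → V →L[ℝ] V) (y : E) :
    (V × (E →L[ℝ] V)) →L[ℝ] (V × (E →L[ℝ] V)) :=
  ((A y).comp (ContinuousLinearMap.fst ℝ V (E →L[ℝ] V))).prod
    ((homOp (A y) (fderiv ℝ X y)).comp (ContinuousLinearMap.snd ℝ V (E →L[ℝ] V)) +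
      (fderiv ℝ A y).flip.comp (ContinuousLinearMap.fst ℝ V (E →L[ℝ] V)))

theorem prolongCoeff_apply (X : E → E) (A : E → V →L[ℝ] V) (y : E) (p : V × (E →L[ℝ] V)) :
    prolongCoeff X A y p =
      (A y p.1, homOp (A y) (fderiv ℝ X y) p.2 + (fderiv ℝ A y).flip p.1) := rfl

theorem contDiffOn_prolongCoeff {U : Set E} (hU : IsOpen U) {X : E → E} (hX : ContDiffOn ℝ ∞ X U)
    {A : E → V →L[ℝ] V} (hA : ContDiffOn ℝ ∞ A U) :
    ContDiffOn ℝ ∞ (prolongCoeff X A) U := by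
  let Φ : (E →L[ℝ] V →L[ℝ] V) →L[ℝ] V →L[ℝ] E →L[ℝ] V :=
    (ContinuousLinearMap.flipₗᵢ ℝ E V V).toContinuousLinearEquiv.toContinuousLinearMap
  have hΦ : ContDiff ℝ ∞ fun f => Φ f := ContinuousLinearMap.contDiff _
  have h1 : ContDiffOn ℝ ∞ (fun y => Φ (fderiv ℝ A y)) U :=
    hΦ.comp_contDiffOn (hA.fderiv_infty hU)
  have h2 := hA.homOp (hX.fderiv_infty hU)
  have h : ContDiffOn ℝ ∞ (fun y =>
      (ContinuousLinearMap.inl ℝ V (E →L[ℝ] V)).comp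
        ((A y).comp (ContinuousLinearMap.fst ℝ V (E →L[ℝ] V))) +
      (ContinuousLinearMap.inr ℝ V (E →L[ℝ] V)).comp
        ((homOp (A y) (fderiv ℝ X y)).comp (ContinuousLinearMap.snd ℝ V (E →L[ℝ] V)) +
          (Φ (fderiv ℝ A y)).comp (ContinuousLinearMap.fst ℝ V (E →L[ℝ] V)))) U :=
    (contDiffOn_const.clm_comp (hA.clm_comp contDiffOn_const)).add
      (contDiffOn_const.clm_comp ((h2.clm_comp contDiffOn_const).add
        (h1.clm_comp contDiffOn_const)))
  refine h.congr fun y _ => ContinuousLinearMap.ext fun p => ?_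
  rw [prolongCoeff_apply]
  simp [Φ]

theorem VanishesToOrder.prodMk_fderiv {U : Set E} (hU : IsOpen U) (h0 : (0 : E) ∈ U) {w : E → V}
    (hw : ContDiffOn ℝ ∞ w U) {k : ℕ} (hwk : VanishesToOrder (k + 1) w) :
    VanishesToOrder k fun y => (w y, _root_.fderiv ℝ w y) := by
  have hU0 := hU.mem_nhds h0
  have h1 := (hwk.mono k.le_succ).clm_apply_left
    (fun _ _ => (hw.contDiffAt hU0).of_le (by exact_mod_cast le_top))
    (ContinuousLinearMap.inl ℝ V (E →L[ℝ] V))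
  have h2 := hwk.fderiv.clm_apply_left
    (fun _ _ => ((hw.fderiv_infty hU).contDiffAt hU0).of_le (by exact_mod_cast le_top))
    (ContinuousLinearMap.inr ℝ V (E →L[ℝ] V))
  have h3 : ContDiff ℝ ∞ (ContinuousLinearMap.inl ℝ V (E →L[ℝ] V)) :=
    ContinuousLinearMap.contDiff _
  have h4 : ContDiff ℝ ∞ (ContinuousLinearMap.inr ℝ V (E →L[ℝ] V)) :=
    ContinuousLinearMap.contDiff _
  have h5 := h1.add h2 ((h3.comp_contDiffOn hw).contDiffAt hU0)
    ((h4.comp_contDiffOn (hw.fderiv_infty hU)).contDiffAt hU0)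
  simpa using h5

variable {U : Set E} {X : E → E} {ε : ℝ} {σ : E → ℝ → E} {A : E → V →L[ℝ] V}

/-- The quadratic estimate behind the differentiability of flow solutions. -/
theorem IsFlowSolution.exists_norm_sub_le [ProperSpace E] (hσ : IsSourceFlow U X ε σ)
    (hU : IsOpen U) (h0 : (0 : E) ∈ U) (hX : ContDiffOn ℝ ∞ X U) (hA : ContDiffOn ℝ ∞ A U) {β : ℝ}
    (hβ0 : 0 < β) (hβ : 2 * ‖A 0‖ ≤ β) {w : E → V} (hw : ContDiffOn ℝ ∞ w U) {M : ℕ}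
    (hwM : VanishesToOrder (M + 2) w) (hβM : β ≤ (M + 2 : ℕ) * ε) {g : E → V × (E →L[ℝ] V)}
    (hg : IsFlowSolution U σ (prolongCoeff X A) (fun y => (w y, fderiv ℝ w y)) β g) {q : E}
    (hq : q ∈ U) :
    ∃ δ > 0, ∃ C : ℝ, ∀ q' ∈ U, ‖q' - q‖ ≤ δ →
      ‖(g q').1 - (g q).1 - (g q).2 (q' - q)‖ ≤ C * ‖q' - q‖ ^ 2 := by
  obtain ⟨Z, hZ, hZU, hqZ⟩ := hσ.compact q hq
  obtain ⟨δ₁, hδ₁, D, hD, hap⟩ := hσ.exists_apriori hU h0 hA hβ0 hβ hq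
  obtain ⟨δ₂, hδ₂, C₂, hC₂, hst⟩ := hσ.stable q hq
  obtain ⟨C₃, hC₃, hdec⟩ := hσ.decay q hq
  obtain ⟨δ₄, hδ₄, C₄, hC₄, htw⟩ := hwM.exists_taylor_le hU h0 hw hZ hZU
  obtain ⟨δ₅, hδ₅, C₅, hC₅, htA⟩ := hA.exists_taylor_le hU hZ hZU
  obtain ⟨δ₆, hδ₆, C₆, hC₆, hlA⟩ := hA.exists_lipschitz_le hU hZ hZU
  obtain ⟨δ₇, hδ₇, C₇, hC₇, htX⟩ := hX.exists_taylor_le hU hZ hZU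
  obtain ⟨hgd, N, hgN⟩ := hg q hq
  have hN0 : 0 ≤ N := nonneg_of_mul_nonneg_left ((norm_nonneg _).trans (hgN 0 le_rfl))
    (Real.exp_pos _)
  set δ₈ := min (min δ₄ δ₅) (min δ₆ δ₇) with hδ₈
  have hδ₈0 : 0 < δ₈ := by positivity
  set K := C₄ * (C₃ + C₂) ^ M * C₂ ^ 2 + (C₅ + C₆ + C₇) * C₂ ^ 2 * N with hK
  have hε := hσ.pos
  refine ⟨min (min δ₁ δ₂) (min 1 (δ₈ / (C₂ + 1))), by positivity, D * K, fun q' hq' hδ => ?_⟩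
  have hδ' := le_min_iff.mp hδ
  have hδ12 := le_min_iff.mp hδ'.1
  have hδ34 := le_min_iff.mp hδ'.2
  set h := ‖q' - q‖ with hh
  have hh0 : 0 ≤ h := norm_nonneg _
  have hξ : ∀ s, 0 ≤ s → ‖σ q' s - σ q s‖ ≤ C₂ * h * Real.exp (-(ε * s)) :=
    hst q' hq' hδ12.2
  have he : ∀ s, 0 ≤ s → Real.exp (-(ε * s)) ≤ 1 := fun s hs =>
    Real.exp_le_one_iff.mpr (by have := mul_nonneg hε.le hs; linarith)
  have hξ1 : ∀ s, 0 ≤ s → ‖σ q' s - σ q s‖ ≤ C₂ * h := fun s hs =>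
    (hξ s hs).trans (mul_le_of_le_one_right (by positivity) (he s hs))
  have hξδ : ∀ s, 0 ≤ s → ‖σ q' s - σ q s‖ ≤ δ₈ := fun s hs => by
    calc _ ≤ C₂ * h := hξ1 s hs
      _ ≤ (C₂ + 1) * (δ₈ / (C₂ + 1)) := by
        gcongr
        · linarith
        · exact hδ34.2
      _ = δ₈ := by field_simp
  obtain ⟨hgd', N', hgN'⟩ := hg q' hq'
  have hd1 : ∀ (f : ℝ → V × (E →L[ℝ] V)) {f' : V × (E →L[ℝ] V)} {s : ℝ},
      HasDerivWithinAt f f' (Set.Ici 0) s → HasDerivWithinAt (fun t => (f t).1) f'.1 (Set.Ici 0) s ∧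
        HasDerivWithinAt (fun t => (f t).2) f'.2 (Set.Ici 0) s := by
    intro f f' s hf
    exact ⟨(ContinuousLinearMap.fst ℝ V (E →L[ℝ] V)).hasFDerivAt.comp_hasDerivWithinAt s hf,
      (ContinuousLinearMap.snd ℝ V (E →L[ℝ] V)).hasFDerivAt.comp_hasDerivWithinAt s hf⟩
  -- The first order Taylor remainder, carried along both trajectories. It solves the equation along
  -- σ q' with right-hand side f: the prolonged equation cancels all first order terms, leaving
  -- Taylor remainders of w, A, X and a product of two first order differences. The a priori
  -- estimate at s = 0 then yields the quadratic bound.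
  let r : ℝ → V := fun s =>
    (g (σ q' s)).1 - (g (σ q s)).1 - (g (σ q s)).2 (σ q' s - σ q s)
  let f : ℝ → V := fun s =>
    (w (σ q' s) - w (σ q s) - fderiv ℝ w (σ q s) (σ q' s - σ q s)) -
    (A (σ q' s) - A (σ q s) - fderiv ℝ A (σ q s) (σ q' s - σ q s)) (g (σ q s)).1 -
    (A (σ q' s) - A (σ q s)) ((g (σ q s)).2 (σ q' s - σ q s)) -
    (g (σ q s)).2 (X (σ q' s) - X (σ q s) - fderiv ℝ X (σ q s) (σ q' s - σ q s))
  have hrd : ∀ s, 0 ≤ s → HasDerivWithinAt r (A (σ q' s) (r s) - f s) (Set.Ici 0) s := by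
    intro s hs
    have h1 := hd1 _ (hgd s hs)
    have h2 := hd1 _ (hgd' s hs)
    have h3 := (hσ.isReversedCurve q' hq' s hs).sub (hσ.isReversedCurve q hq s hs)
    refine ((h2.1.sub h1.1).sub (h1.2.clm_apply h3)).congr_deriv ?_
    simp only [prolongCoeff_apply, homOp_apply, Prod.fst_sub, Prod.snd_sub, r, f, map_sub, map_neg,
      sub_apply, add_apply, ContinuousLinearMap.coe_comp,
      Function.comp_apply, ContinuousLinearMap.flip_apply, Pi.sub_apply]
    abel
  have hfb : ∀ s, 0 ≤ s → ‖f s‖ ≤ K * h ^ 2 * Real.exp (-(β * s)) := by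
    intro s hs
    have hu1 : ‖(g (σ q s)).1‖ ≤ N * Real.exp (-(β * s)) := (norm_fst_le _).trans (hgN s hs)
    have hu2 : ‖(g (σ q s)).2‖ ≤ N * Real.exp (-(β * s)) := (norm_snd_le _).trans (hgN s hs)
    have hle := hξδ s hs
    rw [hδ₈, le_min_iff, le_min_iff, le_min_iff] at hle
    have hexp := Real.exp_pos (-(β * s))
    have hsq : ‖σ q' s - σ q s‖ ^ 2 ≤ C₂ ^ 2 * h ^ 2 := by
      rw [← mul_pow]
      exact pow_le_pow_left₀ (norm_nonneg _) (hξ1 s hs) 2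
    -- The weight contributes M factors e^(-εs) and the squared distance two more, matching β ≤ (M +
    -- 2)ε.
    have t1 : ‖w (σ q' s) - w (σ q s) - fderiv ℝ w (σ q s) (σ q' s - σ q s)‖ ≤
        C₄ * (C₃ + C₂) ^ M * C₂ ^ 2 * h ^ 2 * Real.exp (-(β * s)) := by
      refine (htw _ (hqZ s) _ hle.1.1).trans ?_
      have hb : ‖σ q s‖ + ‖σ q' s - σ q s‖ ≤ (C₃ + C₂) * Real.exp (-(ε * s)) := by
        rw [add_mul]
        refine add_le_add (hdec s hs) ((hξ s hs).trans ?_)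
        gcongr
        exact mul_le_of_le_one_right hC₂ hδ34.1
      calc _ ≤ C₄ * ((C₃ + C₂) * Real.exp (-(ε * s))) ^ M *
            (C₂ * h * Real.exp (-(ε * s))) ^ 2 := by
            gcongr
            exact hξ s hs
        _ = C₄ * (C₃ + C₂) ^ M * C₂ ^ 2 * h ^ 2 * Real.exp (-(ε * s)) ^ (M + 2) := by
          rw [mul_pow _ _ M, pow_add]; ring
        _ ≤ _ := by
          rw [exp_neg_mul_pow]
          have := exp_neg_mul_le_of_le hβM hs
          gcongr
    have t2 : ‖(A (σ q' s) - A (σ q s) - fderiv ℝ A (σ q s) (σ q' s - σ q s)) (g (σ q s)).1‖ ≤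
        C₅ * C₂ ^ 2 * N * h ^ 2 * Real.exp (-(β * s)) := by
      calc _ ≤ ‖A (σ q' s) - A (σ q s) - fderiv ℝ A (σ q s) (σ q' s - σ q s)‖ *
            ‖(g (σ q s)).1‖ := ContinuousLinearMap.le_opNorm _ _
        _ ≤ C₅ * (C₂ ^ 2 * h ^ 2) * (N * Real.exp (-(β * s))) := by
          gcongr
          exact (htA _ (hqZ s) _ hle.1.2).trans (by gcongr)
        _ = _ := by ring
    have t3 : ‖(A (σ q' s) - A (σ q s)) ((g (σ q s)).2 (σ q' s - σ q s))‖ ≤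
        C₆ * C₂ ^ 2 * N * h ^ 2 * Real.exp (-(β * s)) := by
      calc _ ≤ ‖A (σ q' s) - A (σ q s)‖ * (‖(g (σ q s)).2‖ * ‖σ q' s - σ q s‖) :=
            (ContinuousLinearMap.le_opNorm _ _).trans
              (mul_le_mul_of_nonneg_left (ContinuousLinearMap.le_opNorm _ _) (norm_nonneg _))
        _ ≤ C₆ * (C₂ * h) * (N * Real.exp (-(β * s)) * (C₂ * h)) := by
          gcongr
          exacts [(hlA _ (hqZ s) _ hle.2.1).trans (by gcongr; exact hξ1 s hs), hξ1 s hs]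
        _ = _ := by ring
    have t4 : ‖(g (σ q s)).2 (X (σ q' s) - X (σ q s) - fderiv ℝ X (σ q s) (σ q' s - σ q s))‖ ≤
        C₇ * C₂ ^ 2 * N * h ^ 2 * Real.exp (-(β * s)) := by
      calc _ ≤ ‖(g (σ q s)).2‖ *
            ‖X (σ q' s) - X (σ q s) - fderiv ℝ X (σ q s) (σ q' s - σ q s)‖ :=
            ContinuousLinearMap.le_opNorm _ _
        _ ≤ (N * Real.exp (-(β * s))) * (C₇ * (C₂ ^ 2 * h ^ 2)) := by
          gcongr
          exact (htX _ (hqZ s) _ hle.2.2).trans (by gcongr)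
        _ = _ := by ring
    have tri : ∀ a b c d : V, ‖a - b - c - d‖ ≤ ‖a‖ + ‖b‖ + ‖c‖ + ‖d‖ := fun a b c d =>
      (norm_sub_le _ _).trans (add_le_add_left ((norm_sub_le _ _).trans
        (add_le_add_left (norm_sub_le _ _) _)) _)
    refine (tri _ _ _ _).trans ((add_le_add (add_le_add (add_le_add t1 t2) t3) t4).trans_eq ?_)
    rw [hK]
    ring
  have hrN : ∀ s, 0 ≤ s → ‖r s‖ ≤ (N' + N + N * (C₂ * h)) * Real.exp (-(β * s)) := by
    intro s hs
    have hu1 : ‖(g (σ q s)).1‖ ≤ N * Real.exp (-(β * s)) := (norm_fst_le _).trans (hgN s hs)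
    have hu1' : ‖(g (σ q' s)).1‖ ≤ N' * Real.exp (-(β * s)) := (norm_fst_le _).trans (hgN' s hs)
    have hu2 : ‖(g (σ q s)).2‖ ≤ N * Real.exp (-(β * s)) := (norm_snd_le _).trans (hgN s hs)
    have hu3 : ‖(g (σ q s)).2 (σ q' s - σ q s)‖ ≤ N * Real.exp (-(β * s)) * (C₂ * h) :=
      (ContinuousLinearMap.le_opNorm _ _).trans (mul_le_mul hu2 (hξ1 s hs) (norm_nonneg _)
        ((norm_nonneg _).trans hu2))
    refine ((norm_sub_le _ _).trans (add_le_add (norm_sub_le _ _) le_rfl)).trans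
      ((add_le_add (add_le_add hu1' hu1) hu3).trans_eq ?_)
    ring
  have hK0 : 0 ≤ K := by positivity
  have key := hap q' hq' hδ12.1 r f (K * h ^ 2) _ (by positivity) hfb hrd hrN 0 le_rfl
  simp only [r, hσ.apply_zero q hq, hσ.apply_zero q' hq', mul_zero, neg_zero, Real.exp_zero,
    mul_one, ← mul_assoc] at key
  exact key

theorem IsFlowSolution.hasFDerivAt [ProperSpace E] (hσ : IsSourceFlow U X ε σ)
    (hU : IsOpen U) (h0 : (0 : E) ∈ U) (hX : ContDiffOn ℝ ∞ X U) (hA : ContDiffOn ℝ ∞ A U) {β : ℝ}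
    (hβ0 : 0 < β) (hβ : 2 * ‖A 0‖ ≤ β) {w : E → V} (hw : ContDiffOn ℝ ∞ w U) {M : ℕ}
    (hwM : VanishesToOrder (M + 2) w) (hβM : β ≤ (M + 2 : ℕ) * ε) {g : E → V × (E →L[ℝ] V)}
    (hg : IsFlowSolution U σ (prolongCoeff X A) (fun y => (w y, fderiv ℝ w y)) β g) {q : E}
    (hq : q ∈ U) : HasFDerivAt (fun y => (g y).1) (g q).2 q := by
  obtain ⟨δ, hδ, C, h⟩ := hg.exists_norm_sub_le hσ hU h0 hX hA hβ0 hβ hw hwM hβM hq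
  refine .of_isLittleO (Asymptotics.IsBigO.trans_isLittleO (g := fun y => ‖y - q‖ ^ 2) ?_
    (Asymptotics.isLittleO_pow_sub_sub q one_lt_two))
  refine Asymptotics.IsBigO.of_bound C ?_
  filter_upwards [hU.mem_nhds hq, Metric.closedBall_mem_nhds q hδ] with y hy hyδ
  rw [norm_pow, norm_norm]
  exact h y hy (by simpa [dist_eq_norm] using hyδ)

theorem IsFlowSolution.fst {β : ℝ} {w : E → V} {g : E → V × (E →L[ℝ] V)}
    (hg : IsFlowSolution U σ (prolongCoeff X A) (fun y => (w y, fderiv ℝ w y)) β g) :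
    IsFlowSolution U σ A w β fun y => (g y).1 := fun q hq => by
  obtain ⟨hd, N, hN⟩ := hg q hq
  exact ⟨fun s hs => (ContinuousLinearMap.fst ℝ V (E →L[ℝ] V)).hasFDerivAt.comp_hasDerivWithinAt s
    (hd s hs), N, fun s hs => (norm_fst_le _).trans (hN s hs)⟩

/-- Flow solutions of high order are smooth of high order. -/
theorem IsSourceFlow.exists_contDiffOn [ProperSpace E] (hσ : IsSourceFlow U X ε σ)
    (hU : IsOpen U) (h0 : (0 : E) ∈ U) (hX : ContDiffOn ℝ ∞ X U) (k : ℕ) {V : Type u}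
    [NormedAddCommGroup V] [NormedSpace ℝ V] [CompleteSpace V] {A : E → V →L[ℝ] V}
    (hA : ContDiffOn ℝ ∞ A U) :
    ∃ β₀ : ℝ, ∀ β, β₀ ≤ β → ∀ M : ℕ, β ≤ M * ε → ∀ w : E → V, ContDiffOn ℝ ∞ w U →
      VanishesToOrder (M + k + 2) w → ∀ u : E → V, IsFlowSolution U σ A w β u →
      ContDiffOn ℝ k u U ∧ VanishesToOrder (k + 1) u := by
  have hε := hσ.pos
  -- reduction to the prolonged equation
  have key : ∀ (V : Type u) [NormedAddCommGroup V] [NormedSpace ℝ V] [CompleteSpace V]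
      (A : E → V →L[ℝ] V), ContDiffOn ℝ ∞ A U → ∀ β, 0 < β → 2 * ‖A 0‖ ≤ β →
      2 * ‖prolongCoeff X A 0‖ ≤ β → ∀ M : ℕ, β ≤ M * ε → ∀ w : E → V, ContDiffOn ℝ ∞ w U →
      ∀ k, VanishesToOrder (M + k + 1) w → 1 ≤ k → ∀ u : E → V, IsFlowSolution U σ A w β u →
      ∃ g, IsFlowSolution U σ (prolongCoeff X A) (fun y => (w y, fderiv ℝ w y)) β g ∧
        ∀ q ∈ U, HasFDerivAt u (g q).2 q := by
    intro V _ _ _ A hA β hβ0 hβ1 hβ2 M hM w hw k hwk hk u hu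
    have hw2 : VanishesToOrder (M + 2) w := hwk.mono (by omega)
    have hw' : ContDiffOn ℝ ∞ (fun y => (w y, fderiv ℝ w y)) U := hw.prodMk (hw.fderiv_infty hU)
    obtain ⟨g, hg⟩ := hσ.exists_isFlowSolution hU h0 (contDiffOn_prolongCoeff hU hX hA) hβ0 hβ2 hw'
      (M := M) ((hw2.prodMk_fderiv hU h0 hw).mono (by omega)) hM
    refine ⟨g, hg, fun q hq => ?_⟩
    have hM2 : β ≤ (M + 2 : ℕ) * ε := hM.trans (by gcongr; omega)
    have h1 := hg.hasFDerivAt hσ hU h0 hX hA hβ0 hβ1 hw hw2 hM2 hq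
    refine h1.congr_of_eventuallyEq ?_
    filter_upwards [hU.mem_nhds hq] with y hy
    exact hu.eqOn hσ hU h0 hA hβ0 hβ1 hg.fst hy
  -- Each derivative replaces A by `prolongCoeff X A`, whose norm at 0 may be larger, and costs w
  -- one order of vanishing. Hence β₀ depends on k and the argument yields finite differentiability
  -- only.
  induction k generalizing V with
  | zero =>
    refine ⟨max 1 (max (2 * ‖A 0‖) (2 * ‖prolongCoeff X A 0‖)),
      fun β hβ M hM w hw hwM u hu => ?_⟩
    simp only [max_le_iff] at hβ
    have hβ0 : 0 < β := by linarith
    obtain ⟨g, -, hd⟩ := key V A hA β hβ0 hβ.2.1 hβ.2.2 M hM w hw 1 hwM le_rfl u hu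
    refine ⟨?_, vanishesToOrder_succ_iff.mpr ⟨hu.apply_zero hσ h0 hβ0, vanishesToOrder_zero _⟩⟩
    rw [Nat.cast_zero, contDiffOn_zero]
    exact fun q hq => (hd q hq).continuousAt.continuousWithinAt
  | succ k ih =>
    have hA' := contDiffOn_prolongCoeff hU hX hA
    obtain ⟨β₀, hβ₀⟩ := ih hA'
    refine ⟨max (max 1 β₀) (max (2 * ‖A 0‖) (2 * ‖prolongCoeff X A 0‖)),
      fun β hβ M hM w hw hwM u hu => ?_⟩
    simp only [max_le_iff] at hβ
    have hβ0 : 0 < β := by linarith [hβ.1.1]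
    obtain ⟨g, hg, hd⟩ := key V A hA β hβ0 hβ.2.1 hβ.2.2 M hM w hw (k + 2) hwM (by omega) u hu
    have hw' : ContDiffOn ℝ ∞ (fun y => (w y, fderiv ℝ w y)) U := hw.prodMk (hw.fderiv_infty hU)
    obtain ⟨hgk, hg0⟩ := hβ₀ β hβ.1.2 M hM _ hw'
      (VanishesToOrder.prodMk_fderiv hU h0 hw (k := M + k + 2) hwM) g hg
    have hsnd : ContDiffOn ℝ k (fun y => (g y).2) U := contDiff_snd.comp_contDiffOn hgk
    constructor
    · rw [Nat.cast_add, Nat.cast_one, contDiffOn_succ_iff_fderiv_of_isOpen hU]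
      refine ⟨fun q hq => (hd q hq).differentiableAt.differentiableWithinAt, by simp, ?_⟩
      exact hsnd.congr fun q hq => (hd q hq).fderiv
    · refine vanishesToOrder_succ_iff.mpr ⟨hu.apply_zero hσ h0 hβ0, ?_⟩
      have h1 := hg0.clm_apply_left (fun j hj => (hgk.contDiffAt (hU.mem_nhds h0)).of_le
        (by exact_mod_cast Nat.lt_succ_iff.mp hj)) (ContinuousLinearMap.snd ℝ V (E →L[ℝ] V))
      refine h1.congr ?_
      filter_upwards [hU.mem_nhds h0] with y hy
      exact (hd y hy).fderiv.symm

end Prolongation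

/-! ### Solving the equation in 𝔪^(N+1) -/

section Jets

universe u

variable {n : ℕ} {𝕜 : Type*} [RCLike 𝕜] {U : TopologicalSpace.Opens (EuclideanSpace ℝ (Fin n))}
  {V : Type u} [NormedAddCommGroup V] [NormedSpace ℝ V] [NormedSpace 𝕜 V] [IsScalarTower ℝ 𝕜 V]

theorem finiteDimensional_continuousMultilinearMap (𝕜 : Type*) [RCLike 𝕜] (E V : Type*)
    [NormedAddCommGroup E] [NormedSpace ℝ E] [FiniteDimensional ℝ E]
    [NormedAddCommGroup V] [NormedSpace ℝ V] [NormedSpace 𝕜 V] [IsScalarTower ℝ 𝕜 V]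
    [FiniteDimensional 𝕜 V] (k : ℕ) :
    FiniteDimensional 𝕜 (ContinuousMultilinearMap ℝ (fun _ : Fin k => E) V) := by
  have : FiniteDimensional ℝ V := FiniteDimensional.trans ℝ 𝕜 V
  have : FiniteDimensional ℝ (ContinuousMultilinearMap ℝ (fun _ : Fin k => E) V) :=
    Module.Finite.of_injective
      (ContinuousMultilinearMap.toMultilinearMapLinear :
        ContinuousMultilinearMap ℝ (fun _ : Fin k => E) V →ₗ[ℝ]
          MultilinearMap ℝ (fun _ : Fin k => E) V)
      ContinuousMultilinearMap.toMultilinearMap_injective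
  exact Module.Finite.of_restrictScalars_finite ℝ 𝕜 _

theorem finiteDimensional_jetSpace [FiniteDimensional 𝕜 V]
    (h0 : (0 : EuclideanSpace ℝ (Fin n)) ∈ U) (N : ℕ) :
    FiniteDimensional 𝕜 (SmoothFun 𝕜 U V ⧸ vanishingIdeal 𝕜 U V h0 N) := by
  have := finiteDimensional_continuousMultilinearMap 𝕜 (EuclideanSpace ℝ (Fin n)) V
  let Φ : SmoothFun 𝕜 U V →ₗ[𝕜] ((k : Fin N) →
      ContinuousMultilinearMap ℝ (fun _ : Fin (k : ℕ) => EuclideanSpace ℝ (Fin n)) V) :=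
    { toFun := fun u k => iteratedFDeriv ℝ k u.1 0
      map_add' := fun u w => funext fun k => iteratedFDeriv_add_apply (i := (k : ℕ))
        ((SmoothFun.contDiffAt u h0).of_le (by exact_mod_cast le_top))
        ((SmoothFun.contDiffAt w h0).of_le (by exact_mod_cast le_top))
      map_smul' := fun c u => funext fun k => iteratedFDeriv_const_smul_apply (i := (k : ℕ))
        ((SmoothFun.contDiffAt u h0).of_le (by exact_mod_cast le_top)) }
  have hker : LinearMap.ker Φ = vanishingIdeal 𝕜 U V h0 N := by
    ext u
    rw [LinearMap.mem_ker, funext_iff]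
    exact ⟨fun h k hk => h ⟨k, hk⟩, fun h k => h k k.2⟩
  rw [← hker]
  exact Module.Finite.equiv Φ.quotKerEquivRange.symm

/-- The operator `D_X + A - c`. -/
noncomputable def shiftedTransportOp (X : SmoothFun ℝ U (EuclideanSpace ℝ (Fin n)))
    (A : SmoothFun 𝕜 U (V →L[𝕜] V)) (c : 𝕜) : SmoothFun 𝕜 U V →ₗ[𝕜] SmoothFun 𝕜 U V :=
  transportOp X A - c • LinearMap.id

/-- The zeroth order coefficient of `D_X + A - c`, as a real linear map. -/
noncomputable def shiftedCoeff (A : SmoothFun 𝕜 U (V →L[𝕜] V)) (c : 𝕜)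
    (y : EuclideanSpace ℝ (Fin n)) : V →L[ℝ] V :=
  (A.1 y).restrictScalars ℝ - c • ContinuousLinearMap.id ℝ V

theorem shiftedTransportOp_apply (X : SmoothFun ℝ U (EuclideanSpace ℝ (Fin n)))
    (A : SmoothFun 𝕜 U (V →L[𝕜] V)) (c : 𝕜) (u : SmoothFun 𝕜 U V)
    (y : EuclideanSpace ℝ (Fin n)) :
    (shiftedTransportOp X A c u).1 y = fderiv ℝ u.1 y (X.1 y) + shiftedCoeff A c y (u.1 y) := by
  change fderiv ℝ u.1 y (X.1 y) + A.1 y (u.1 y) - c • u.1 y =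
    fderiv ℝ u.1 y (X.1 y) + (A.1 y (u.1 y) - c • u.1 y)
  abel

theorem contDiffOn_shiftedCoeff (A : SmoothFun 𝕜 U (V →L[𝕜] V)) (c : 𝕜) :
    ContDiffOn ℝ ∞ (shiftedCoeff A c) U :=
  ((ContinuousLinearMap.restrictScalarsL 𝕜 V V ℝ ℝ).contDiff.comp_contDiffOn A.2.1).sub
    contDiffOn_const

variable {X : SmoothFun ℝ U (EuclideanSpace ℝ (Fin n))} {A : SmoothFun 𝕜 U (V →L[𝕜] V)} {c : 𝕜}

theorem shiftedTransportOp_mem_vanishingIdeal (h0 : (0 : EuclideanSpace ℝ (Fin n)) ∈ U)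
    (hX0 : X.1 0 = 0) {k : ℕ} {u : SmoothFun 𝕜 U V} (hu : u ∈ vanishingIdeal 𝕜 U V h0 k) :
    shiftedTransportOp X A c u ∈ vanishingIdeal 𝕜 U V h0 k :=
  Submodule.sub_mem _ (vanishingIdeal_le_comap_transportOp h0 X hX0 A k hu)
    (Submodule.smul_mem _ c hu)

/-- The order of vanishing rises one step at a time: up to N + 1 by assumption on u, beyond that by
nonresonance. -/
theorem mem_vanishingIdeal_of_shiftedTransportOp (h0 : (0 : EuclideanSpace ℝ (Fin n)) ∈ U)
    (hX0 : X.1 0 = 0) {N : ℕ}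
    (hres : ∀ k, N < k → NonresonantAt (fderiv ℝ X.1 0) k (shiftedCoeff A c 0)) {M : ℕ}
    {u : SmoothFun 𝕜 U V} (hu : u ∈ vanishingIdeal 𝕜 U V h0 (N + 1))
    (hLu : shiftedTransportOp X A c u ∈ vanishingIdeal 𝕜 U V h0 M) :
    u ∈ vanishingIdeal 𝕜 U V h0 M := by
  induction M with
  | zero => exact vanishesToOrder_zero u.1
  | succ M ih =>
    rcases le_or_gt M N with h | h
    · exact VanishesToOrder.mono (by omega) hu
    · have hM := ih (VanishesToOrder.mono M.le_succ hLu)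
      refine VanishesToOrder.succ_of_transport U.isOpen h0 X.2.1 hX0 (contDiffOn_shiftedCoeff A c)
        (hres M h) u.2.1 hM ?_
      simp only [← shiftedTransportOp_apply]
      exact hLu

/-- The image of 𝔪^(N+1) in the finite-dimensional quotient by 𝔪^M is invariant, and the operator is
injective on it by formal injectivity, hence surjective. -/
theorem exists_shiftedTransportOp_sub_mem [FiniteDimensional 𝕜 V]
    (h0 : (0 : EuclideanSpace ℝ (Fin n)) ∈ U) (hX0 : X.1 0 = 0) {N : ℕ}
    (hres : ∀ k, N < k → NonresonantAt (fderiv ℝ X.1 0) k (shiftedCoeff A c 0)) (M : ℕ)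
    {w : SmoothFun 𝕜 U V} (hw : w ∈ vanishingIdeal 𝕜 U V h0 (N + 1)) :
    ∃ p ∈ vanishingIdeal 𝕜 U V h0 (N + 1),
      shiftedTransportOp X A c p - w ∈ vanishingIdeal 𝕜 U V h0 M := by
  have hfin := finiteDimensional_jetSpace (𝕜 := 𝕜) (V := V) h0 M
  set R := vanishingIdeal 𝕜 U V h0 M
  let L' : (SmoothFun 𝕜 U V ⧸ R) →ₗ[𝕜] (SmoothFun 𝕜 U V ⧸ R) :=
    R.mapQ R (shiftedTransportOp X A c)
      fun _ hu => shiftedTransportOp_mem_vanishingIdeal h0 hX0 hu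
  let S' := (vanishingIdeal 𝕜 U V h0 (N + 1)).map R.mkQ
  have hS' : ∀ x ∈ S', L' x ∈ S' := by
    rintro _ ⟨p, hp, rfl⟩
    exact ⟨shiftedTransportOp X A c p, shiftedTransportOp_mem_vanishingIdeal h0 hX0 hp, rfl⟩
  have hinj : Function.Injective (L'.restrict hS') := by
    refine (injective_iff_map_eq_zero _).mpr ?_
    rintro ⟨_, p, hp, rfl⟩ hx
    have h1 : R.mkQ (shiftedTransportOp X A c p) = 0 := congrArg Subtype.val hx
    have h2 := mem_vanishingIdeal_of_shiftedTransportOp h0 hX0 hres hp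
      ((Submodule.Quotient.mk_eq_zero R).mp h1)
    exact Subtype.ext ((Submodule.Quotient.mk_eq_zero R).mpr h2)
  obtain ⟨⟨_, p, hp, rfl⟩, hx⟩ := LinearMap.injective_iff_surjective.mp hinj
    ⟨R.mkQ w, w, hw, rfl⟩
  have h1 : R.mkQ (shiftedTransportOp X A c p) = R.mkQ w := congrArg Subtype.val hx
  exact ⟨p, hp, (Submodule.Quotient.eq R).mp h1⟩

theorem isFlowSolution_smoothFun {ε : ℝ}
    {σ : EuclideanSpace ℝ (Fin n) → ℝ → EuclideanSpace ℝ (Fin n)}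
    (hσ : IsSourceFlow (U : Set (EuclideanSpace ℝ (Fin n))) X.1 ε σ)
    (h0 : (0 : EuclideanSpace ℝ (Fin n)) ∈ U) {M : ℕ} {p : SmoothFun 𝕜 U V}
    (hp : p ∈ vanishingIdeal 𝕜 U V h0 M) {β : ℝ} (hβ : β ≤ M * ε) :
    IsFlowSolution (U : Set (EuclideanSpace ℝ (Fin n))) σ (shiftedCoeff A c)
      (shiftedTransportOp X A c p).1 β p.1 := by
  have := isFlowSolution_of_contDiffOn (A := shiftedCoeff A c) hσ U.isOpen h0 p.2.1 hp hβ
  simpa only [← shiftedTransportOp_apply] using this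

/-- The accuracy of p is chosen after the threshold β₀ for k derivatives is known. The rate β and
the order M₀ in the conclusion do not depend on k, which is what lets the pairs (p, s) for different
k be compared. -/
theorem exists_approximate_solution [FiniteDimensional 𝕜 V] {ε : ℝ}
    {σ : EuclideanSpace ℝ (Fin n) → ℝ → EuclideanSpace ℝ (Fin n)}
    (hσ : IsSourceFlow (U : Set (EuclideanSpace ℝ (Fin n))) X.1 ε σ)
    (h0 : (0 : EuclideanSpace ℝ (Fin n)) ∈ U) (hX0 : X.1 0 = 0) {N : ℕ}
    (hres : ∀ k, N < k → NonresonantAt (fderiv ℝ X.1 0) k (shiftedCoeff A c 0))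
    {β : ℝ} (hβ0 : 0 < β) (hβ : 2 * ‖shiftedCoeff A c 0‖ ≤ β) (M₀ : ℕ)
    {w : SmoothFun 𝕜 U V} (hw : w ∈ vanishingIdeal 𝕜 U V h0 (N + 1)) (k : ℕ) :
    ∃ p ∈ vanishingIdeal 𝕜 U V h0 (N + 1), ∃ s : EuclideanSpace ℝ (Fin n) → V,
      shiftedTransportOp X A c p - w ∈ vanishingIdeal 𝕜 U V h0 M₀ ∧
      IsFlowSolution (U : Set (EuclideanSpace ℝ (Fin n))) σ (shiftedCoeff A c)
        (shiftedTransportOp X A c p - w).1 β s ∧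
      ContDiffOn ℝ k s U ∧ VanishesToOrder (k + 1) s := by
  have : FiniteDimensional ℝ V := FiniteDimensional.trans ℝ 𝕜 V
  have : CompleteSpace V := FiniteDimensional.complete ℝ V
  have hA := contDiffOn_shiftedCoeff A c
  obtain ⟨β₀, h⟩ := hσ.exists_contDiffOn U.isOpen h0 X.2.1 k hA
  obtain ⟨M, hM⟩ := exists_nat_ge (max β β₀ / ε)
  rw [div_le_iff₀ hσ.pos] at hM
  obtain ⟨p, hp, hpw⟩ := exists_shiftedTransportOp_sub_mem h0 hX0 hres (max M₀ (M + k + 2)) hw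
  have hpw' : VanishesToOrder (M + k + 2) (shiftedTransportOp X A c p - w).1 :=
    VanishesToOrder.mono (le_max_right _ _) hpw
  obtain ⟨s, hs⟩ := hσ.exists_isFlowSolution U.isOpen h0 hA (β := max β β₀)
    (hβ0.trans_le (le_max_left _ _)) (hβ.trans (le_max_left _ _))
    (shiftedTransportOp X A c p - w).2.1 (M := M) (hpw'.mono (by omega)) hM
  obtain ⟨hsk, hs0⟩ := h _ (le_max_right _ _) M hM _ (shiftedTransportOp X A c p - w).2.1 hpw' s hs
  exact ⟨p, hp, s, VanishesToOrder.mono (le_max_left _ _) hpw, hs.mono (le_max_left _ _), hsk, hs0⟩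

/-- By formal injectivity a kernel element vanishes to any prescribed order, so it decays fast along
trajectories and uniqueness compares it with 0. -/
theorem eq_zero_of_shiftedTransportOp_eq_zero {ε : ℝ}
    {σ : EuclideanSpace ℝ (Fin n) → ℝ → EuclideanSpace ℝ (Fin n)}
    (hσ : IsSourceFlow (U : Set (EuclideanSpace ℝ (Fin n))) X.1 ε σ)
    (h0 : (0 : EuclideanSpace ℝ (Fin n)) ∈ U) (hX0 : X.1 0 = 0) {N : ℕ}
    (hres : ∀ k, N < k → NonresonantAt (fderiv ℝ X.1 0) k (shiftedCoeff A c 0))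
    {u : SmoothFun 𝕜 U V} (hu : u ∈ vanishingIdeal 𝕜 U V h0 (N + 1))
    (hLu : shiftedTransportOp X A c u = 0) : u = 0 := by
  set β := max 1 (2 * ‖shiftedCoeff A c 0‖)
  obtain ⟨M, hM⟩ := exists_nat_ge (β / ε)
  rw [div_le_iff₀ hσ.pos] at hM
  have hs : ∀ p ∈ vanishingIdeal 𝕜 U V h0 (N + 1), shiftedTransportOp X A c p = 0 →
      IsFlowSolution (U : Set (EuclideanSpace ℝ (Fin n))) σ (shiftedCoeff A c)
        (0 : SmoothFun 𝕜 U V).1 β p.1 := fun p hp hLp => by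
    have := isFlowSolution_smoothFun (X := X) (A := A) (c := c) hσ h0
      (mem_vanishingIdeal_of_shiftedTransportOp (M := M) h0 hX0 hres hp
        (hLp ▸ Submodule.zero_mem _)) hM
    rwa [hLp] at this
  have heq := (hs u hu hLu).eqOn hσ U.isOpen h0 (contDiffOn_shiftedCoeff A c)
    (one_pos.trans_le (le_max_left _ _)) (le_max_right _ _)
    (hs 0 (Submodule.zero_mem _) (map_zero _))
  refine Subtype.ext (funext fun y => ?_)
  by_cases hy : y ∈ U
  · exact heq hy
  · exact u.2.2 y hy

theorem exists_shiftedTransportOp_eq [FiniteDimensional 𝕜 V] {ε : ℝ}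
    {σ : EuclideanSpace ℝ (Fin n) → ℝ → EuclideanSpace ℝ (Fin n)}
    (hσ : IsSourceFlow (U : Set (EuclideanSpace ℝ (Fin n))) X.1 ε σ)
    (h0 : (0 : EuclideanSpace ℝ (Fin n)) ∈ U) (hX0 : X.1 0 = 0) {N : ℕ}
    (hres : ∀ k, N < k → NonresonantAt (fderiv ℝ X.1 0) k (shiftedCoeff A c 0))
    {w : SmoothFun 𝕜 U V} (hw : w ∈ vanishingIdeal 𝕜 U V h0 (N + 1)) :
    ∃ u ∈ vanishingIdeal 𝕜 U V h0 (N + 1), shiftedTransportOp X A c u = w := by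
  classical
  have hA := contDiffOn_shiftedCoeff A c
  set β := max 1 (2 * ‖shiftedCoeff A c 0‖)
  have hβ0 : 0 < β := one_pos.trans_le (le_max_left _ _)
  have hβ : 2 * ‖shiftedCoeff A c 0‖ ≤ β := le_max_right _ _
  obtain ⟨M, hM⟩ := exists_nat_ge (β / ε)
  rw [div_le_iff₀ hσ.pos] at hM
  choose p hp s hpw hs hsk hs0 using fun k =>
    exists_approximate_solution hσ h0 hX0 hres hβ0 hβ M hw k
  -- Formal injectivity puts p_k - p_0 in 𝔪^M, so it decays at rate β. It and s_k - s_0 are then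
  -- flow solutions with the same right-hand side, hence equal on U.
  have heq : ∀ k, ∀ y ∈ U, (p k).1 y - s k y = (p 0).1 y - s 0 y := by
    intro k y hy
    have h1 : p k - p 0 ∈ vanishingIdeal 𝕜 U V h0 M := by
      refine mem_vanishingIdeal_of_shiftedTransportOp (X := X) (A := A) (c := c) h0 hX0 hres
        (Submodule.sub_mem _ (hp k) (hp 0)) ?_
      have := Submodule.sub_mem _ (hpw k) (hpw 0)
      rwa [sub_sub_sub_cancel_right, ← map_sub] at this
    have h2 := isFlowSolution_smoothFun (X := X) (A := A) (c := c) hσ h0 h1 hM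
    have h3 : IsFlowSolution (U : Set (EuclideanSpace ℝ (Fin n))) σ (shiftedCoeff A c)
        (shiftedTransportOp X A c (p k - p 0)).1 β (fun y => s k y - s 0 y) := by
      have h4 : (shiftedTransportOp X A c (p k - p 0)).1 = fun y =>
          (shiftedTransportOp X A c (p k) - w).1 y - (shiftedTransportOp X A c (p 0) - w).1 y := by
        have : shiftedTransportOp X A c (p k - p 0) =
            (shiftedTransportOp X A c (p k) - w) - (shiftedTransportOp X A c (p 0) - w) := by
          rw [map_sub]; abel
        rw [this]
        rfl
      rw [h4]
      exact (hs k).sub (hs 0)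
    have h5 : (p k).1 y - (p 0).1 y = s k y - s 0 y :=
      h2.eqOn hσ U.isOpen h0 hA hβ0 hβ h3 hy
    rw [sub_eq_sub_iff_add_eq_add] at h5 ⊢
    rw [h5, add_comm]
  let f : EuclideanSpace ℝ (Fin n) → V := fun y => if y ∈ U then (p 0).1 y - s 0 y else 0
  have hf : ∀ k, ∀ y ∈ U, f y = (p k).1 y - s k y := fun k y hy => by
    rw [heq k y hy]; exact if_pos hy
  have hfs : ContDiffOn ℝ ∞ f U := by
    rw [contDiffOn_infty]
    intro k
    exact (((p k).2.1.of_le (by exact_mod_cast le_top)).sub (hsk k)).congr (hf k)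
  let u : SmoothFun 𝕜 U V := ⟨f, hfs, fun y hy => if_neg hy⟩
  have hpu : ∀ k, ∀ y ∈ U, (p k - u).1 y = s k y := fun k y hy => by
    change (p k).1 y - f y = s k y
    rw [hf k y hy]; abel
  refine ⟨u, ?_, ?_⟩
  -- The index k = N is taken because s_N vanishes to order N + 1.
  · have h1 : p N - u ∈ vanishingIdeal 𝕜 U V h0 (N + 1) := by
      refine VanishesToOrder.congr (hs0 N) ?_
      filter_upwards [U.isOpen.mem_nhds h0] with y hy
      exact (hpu N y hy).symm
    have := Submodule.sub_mem _ (hp N) h1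
    rwa [sub_sub_cancel] at this
  -- Now that p_0 - u = s_0 is known to be smooth, the equation along trajectories gives L(p_0 - u)
  -- = L p_0 - w on U, that is Lu = w.
  · have h1 : IsFlowSolution (U : Set (EuclideanSpace ℝ (Fin n))) σ (shiftedCoeff A c)
        (shiftedTransportOp X A c (p 0) - w).1 β (p 0 - u).1 := by
      intro q hq
      obtain ⟨hd, C, hC⟩ := hs 0 q hq
      have hqs : ∀ t, (p 0 - u).1 (σ q t) = s 0 (σ q t) := fun t => hpu 0 _ (hσ.mem q hq t)
      refine ⟨fun t ht => ?_, C, fun t ht => by rw [hqs]; exact hC t ht⟩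
      simp only [hqs]
      exact hd t ht
    have h2 : shiftedTransportOp X A c (p 0 - u) = shiftedTransportOp X A c (p 0) - w := by
      refine Subtype.ext (funext fun y => ?_)
      by_cases hy : y ∈ U
      · rw [shiftedTransportOp_apply]
        exact h1.transport_eq hσ hy
          ((p 0 - u).2.1.differentiableAt_infty U.isOpen hy)
      · rw [(shiftedTransportOp X A c (p 0 - u)).2.2 y hy,
          (shiftedTransportOp X A c (p 0) - w).2.2 y hy]
    rw [map_sub] at h2
    exact sub_right_inj.mp h2

end Jets

/-! ### The correspondence theorem -/

theorem exists_multiIndex_of_forall_mem_range {n : ℕ} (μ : Fin n → ℂ) (s : Multiset ℂ)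
    (hs : ∀ β ∈ s, ∃ i, μ i = β) :
    ∃ α : Fin n → ℕ, ∑ i, α i = s.card ∧ ∑ i, (α i : ℂ) * μ i = s.sum := by
  induction s using Multiset.induction with
  | empty => exact ⟨0, by simp⟩
  | cons a s ih =>
    obtain ⟨α, h1, h2⟩ := ih fun β hβ => hs β (Multiset.mem_cons_of_mem hβ)
    obtain ⟨i, rfl⟩ := hs a (Multiset.mem_cons_self a s)
    refine ⟨α + Pi.single i 1, ?_, ?_⟩
    · simp [Finset.sum_add_distrib, h1]
    · simp only [Pi.add_apply, Nat.cast_add, add_mul, Finset.sum_add_distrib, h2,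
        Multiset.sum_cons]
      rw [add_comm, Finset.sum_eq_single i]
      · simp
      · intro j _ hj; simp [hj]
      · simp

theorem mainTheorem5 {𝕜 : Type*} [RCLike 𝕜] {n : ℕ}
    {V : Type*} [NormedAddCommGroup V] [NormedSpace ℝ V] [NormedSpace 𝕜 V] [IsScalarTower ℝ 𝕜 V]
    [FiniteDimensional 𝕜 V]
    (U : TopologicalSpace.Opens (EuclideanSpace ℝ (Fin n)))
    (h0 : (0 : EuclideanSpace ℝ (Fin n)) ∈ U)
    (X : SmoothFun ℝ U (EuclideanSpace ℝ (Fin n)))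
    (hX : IsStrictlyPositiveSource X) (hU : IsStarShaped X)
    (A : SmoothFun 𝕜 U (V →L[𝕜] V)) (v : SmoothFun 𝕜 U V)
    (c : 𝕜) (N : ℕ)
    -- `μ 0, …, μ (n - 1)` are the eigenvalues of the linearization of `X`, with multiplicity
    (μ : Fin n → ℂ) (hμ : Finset.univ.val.map μ = complexEigenvalues (linearization X))
    (hN : ∀ (α : Fin n → ℕ) (ρ : ℂ),
      ρ ∈ complexEigenvalues (A.1 0 : V →ₗ[𝕜] V) →
      scalarToComplex 𝕜 c = ∑ i, (α i : ℂ) * μ i + ρ → ∑ i, α i ≤ N) :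
    FiniteDimensional 𝕜 (JetSpace 𝕜 U V h0 N) ∧
    Set.BijOn (jet 𝕜 U V h0 N)
      (solutionSpace (transportOp X A) c v : Set (SmoothFun 𝕜 U V))
      (solutionSpace (jetOp h0 X hX.apply_zero A N) c (jet 𝕜 U V h0 N v) :
        Set (JetSpace 𝕜 U V h0 N)) ∧
    ∀ [Nonempty (solutionSpace (transportOp X A) c v)]
      [Nonempty (solutionSpace (jetOp h0 X hX.apply_zero A N) c (jet 𝕜 U V h0 N v))],
      ∃ e : solutionSpace (transportOp X A) c v ≃ᵃ[𝕜]
          solutionSpace (jetOp h0 X hX.apply_zero A N) c (jet 𝕜 U V h0 N v),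
        ∀ u : solutionSpace (transportOp X A) c v,
          (e u : JetSpace 𝕜 U V h0 N) = jet 𝕜 U V h0 N (u : SmoothFun 𝕜 U V) := by
  have hX0 := hX.apply_zero
  obtain ⟨ε, σ, hσ⟩ := exists_isSourceFlow U.isOpen h0 X.2.1 hX0 hX.re_pos hU
  have hres : ∀ k, N < k → NonresonantAt (fderiv ℝ X.1 0) k (shiftedCoeff A c 0) := by
    intro k hk
    refine nonresonantAt_of_forall_ne (fderiv ℝ X.1 0) c k (A.1 0 : V →ₗ[𝕜] V) _
      (fun x => rfl) fun s ρ hs hsB hρ heq => ?_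
    obtain ⟨α, hα, hαs⟩ := exists_multiIndex_of_forall_mem_range μ s fun β hβ => by
      have h1 : β ∈ complexEigenvalues (linearization X) := hsB β hβ
      rw [← hμ] at h1
      simpa using h1
    have := hN α ρ hρ (by rw [hαs, heq])
    omega
  have hjet : ∀ u, jetOp h0 X hX0 A N (jet 𝕜 U V h0 N u) = jet 𝕜 U V h0 N (transportOp X A u) :=
    fun u => rfl
  have hjet0 : ∀ u, jet 𝕜 U V h0 N u = 0 ↔ u ∈ vanishingIdeal 𝕜 U V h0 (N + 1) :=
    fun u => Submodule.Quotient.mk_eq_zero _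
  have hsol : ∀ u, u ∈ solutionSpace (transportOp X A) c v ↔ shiftedTransportOp X A c u = v :=
    fun u => by
      change transportOp X A u = c • u + v ↔ transportOp X A u - c • u = v
      rw [sub_eq_iff_eq_add, add_comm]
  have hbij : Set.BijOn (jet 𝕜 U V h0 N)
      (solutionSpace (transportOp X A) c v : Set (SmoothFun 𝕜 U V))
      (solutionSpace (jetOp h0 X hX0 A N) c (jet 𝕜 U V h0 N v) : Set (JetSpace 𝕜 U V h0 N)) := by
    refine ⟨fun u hu => ?_, fun u hu u' hu' huu' => ?_, fun x hx => ?_⟩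
    · have hu' : transportOp X A u = c • u + v := hu
      change jetOp h0 X hX0 A N (jet 𝕜 U V h0 N u) = c • jet 𝕜 U V h0 N u + jet 𝕜 U V h0 N v
      rw [hjet, hu', map_add, map_smul]
    · refine sub_eq_zero.mp (eq_zero_of_shiftedTransportOp_eq_zero (X := X) (A := A) (c := c) hσ h0
        hX0 hres ((hjet0 _).mp (by rw [map_sub, huu', sub_self])) ?_)
      rw [map_sub, (hsol u).mp hu, (hsol u').mp hu', sub_self]
    · obtain ⟨w, rfl⟩ := Submodule.mkQ_surjective _ x
      have hx' : jetOp h0 X hX0 A N (jet 𝕜 U V h0 N w) =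
        c • jet 𝕜 U V h0 N w + jet 𝕜 U V h0 N v := hx
      have hmem : shiftedTransportOp X A c w - v ∈ vanishingIdeal 𝕜 U V h0 (N + 1) := by
        rw [← hjet0]
        change jet 𝕜 U V h0 N (transportOp X A w - c • w - v) = 0
        rw [map_sub, map_sub, ← hjet, hx', map_smul]
        abel
      -- The defect Lw - v of a representative w lies in 𝔪^(N+1), so it equals Lz with z in 𝔪^(N+1);
      -- subtracting z removes the defect without changing the jet.
      obtain ⟨z, hz, hLz⟩ := exists_shiftedTransportOp_eq (X := X) (A := A) (c := c) hσ h0 hX0 hres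
        hmem
      refine ⟨w - z, (hsol _).mpr ?_, ?_⟩
      · rw [map_sub, hLz, sub_sub_cancel]
      · rw [map_sub, (hjet0 z).mpr hz, sub_zero]
        rfl
  refine ⟨finiteDimensional_jetSpace h0 (N + 1), hbij, ?_⟩
  intro _ _
  have hmap : (solutionSpace (transportOp X A) c v).map (jet 𝕜 U V h0 N).toAffineMap ≤
      solutionSpace (jetOp h0 X hX0 A N) c (jet 𝕜 U V h0 N v) := by
    rintro _ ⟨u, hu, rfl⟩
    exact hbij.mapsTo hu
  refine ⟨AffineEquiv.ofBijective (φ := AffineMap.restrict (jet 𝕜 U V h0 N).toAffineMap hmap)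
    ⟨fun u u' h => ?_, fun x => ?_⟩, fun u => rfl⟩
  · exact Subtype.ext (hbij.injOn u.2 u'.2 (congrArg Subtype.val h))
  · obtain ⟨u, hu, hux⟩ := hbij.surjOn x.2
    exact ⟨⟨u, hu⟩, Subtype.ext hux⟩
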